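/- **Setting.** Let $d\ge1$, let $\Omega\subset\mathbb R^d$ be a bounded open set and $\Gamma_D\subseteq\partial\Omega$. Let $V$ be the set of $v\in H^1(\Omega)$ (complex-valued) whose trace vanishes on $\Gamma_D$, i.e. for which there are $\varphi_n\in C_c^\infty(\mathbb R^d)$ with $\varphi_n\to v$ in $H^1(\Omega)$ and $\varphi_n|_{\Gamma_D}\to0$ in $L^2(\Gamma_D)$ with respect to the $(d-1)$-dimensional Hausdorff measure; $\|v\|_V=\|v\|_{H^1(\Omega)}$, and $\|\cdot\|$, $(\cdot,\cdot)$ are the norm and inner product of $L^2(\Omega)$. Let $\mathbf C$, $\mathbf a$, $r$ be a complex $d\times d$-matrix-valued, a complex vector-valued and a complex scalar-valued function such that the sesquilinear form $$A(w,v)=\int_\Omega \nabla w\,\mathbf C(x)\,(\overline{\nabla v})^T+(\mathbf a(x)\cdot\nabla)w\,\overline v+r(x)\,w\,\overline v\,dx$$ is defined (its integrand is integrable) for all $w,v\in V$, and suppose that for some $c_0,c_1>0$ $$\Re A(v,v)\ge c_0\|v\|_V^2,\qquad |A(w,v)|\le c_1\|w\|_V\|v\|_V\qquad\text{for all }w,v\in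 V.$$ Let $\beta\ge0$ be the index of $A$ (equivalently, of the associated regularly accretive operator), that is, the smallest $\beta\ge 0$ with $|\Im A(v,v)|\le\beta\,\Re A(v,v)$ for all $v\in V$. Let $V_h\subset V$ be any finite-dimensional subspace (for instance the continuous piecewise linear finite element functions in $V$), let the discrete counterpart $\mathcal A_h:V_h\to V_h$ of $A$ be given by $(\mathcal A_hw,v)=A(w,v)$ for all $w,v\in V_h$, let $f\in L^2(\Omega)$, and let $f_h\in V_h$ be its $L^2$-projection onto $V_h$. Let $\alpha\in(0,1)$, $b>0$, and $$u_h=(\mathcal A_h^\alpha+b\mathcal I)^{-1}f_h,\qquad \mathcal A_h^\alpha=\frac1{2\pi\mathrm i}\int_{\mathcal C'}z^\alpha(z\mathcal I-\mathcal A_h)^{-1}dz,$$ with $z^\alpha$ the principal branch and $\mathcal C'$ a positively oriented circle that surrounds the spectrum of $\mathcal A_h$ and that, together with its interior, does not meet $(-\infty,0]$. For a step size $\tau>0$ let $$u_{h,\tau}=\frac{\sin\pi\alpha}{\alpha\pi}\,\tau\sum_{n=-\infty}^{\infty}\frac{(\mathcal I+e^{-n\tau/\alpha}\mathcal A_h)^{-1}f_h}{e^{n\tau}+2b\cos\pi\alpha+b^2e^{-n\tau}}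 .$$ **Theorem.** Let $\kappa_1=\alpha(\pi-\arctan\beta)$ and $\kappa_2=(1-\alpha)\pi$. If $0<\tau<\pi-\arctan\beta$, then all objects above are well defined (a circle $\mathcal C'$ exists, the operators $\mathcal A_h^\alpha+b\mathcal I$ and $\mathcal I+e^{-s/\alpha}\mathcal A_h$, $s\in\mathbb R$, are invertible, and the series converges), and $$\|u_h-u_{h,\tau}\|\le\frac{C(\alpha)}{b}\,C(\tau)\,e^{-2\pi\min(\kappa_1,\kappa_2)/\tau}\,\|f_h\|,$$ where $$C(\tau)=\begin{cases}\dfrac{1+|\ln\tau|}{\sin\left(\min\left\{\frac{\kappa_1-\kappa_2}{\alpha}+\frac{1-\alpha}{\alpha}\tau,\ \frac\pi2\right\}\right)},&\kappa_1>\kappa_2,\\[3ex]\dfrac{1+|\ln(\kappa_2-\kappa_1+\alpha\tau)|}{\sin\left(\min\left\{\tau,\ \frac\pi2\right\}\right)},&\kappa_1\le\kappa_2,\end{cases}$$ and $C(\alpha)>0$ is a constant that depends only on $\alpha$. -/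

import Mathlib

open MeasureTheory Filter Topology
open scoped ContDiff

noncomputable section

/-! ## The function spaces -/

/-- `ℝ^d` with the Euclidean norm. -/
abbrev Eucl (d : ℕ) : Type := EuclideanSpace ℝ (Fin d)

/-- The complex Hilbert space `L²(Ω)`. -/
abbrev L2C {d : ℕ} (Ω : Set (Eucl d)) : Type := Lp ℂ 2 (volume.restrict Ω)

/-- The classical partial derivative `∂φ/∂x_i`. -/
def partialDeriv {d : ℕ} {F : Type*} [NormedAddCommGroup F] [NormedSpace ℝ F]
    (i : Fin d) (φ : Eucl d → F) (x : Eucl d) : F :=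
  fderiv ℝ φ x (EuclideanSpace.single i (1 : ℝ))

/-- `g = (g_1, …, g_d) ∈ L²(Ω)^d` is the weak gradient of `v ∈ L²(Ω)`:
`∫_Ω v ∂_i φ = - ∫_Ω g_i φ` for all test functions `φ ∈ C_c^∞(Ω)`. -/
def IsWeakGrad {d : ℕ} (Ω : Set (Eucl d)) (v : L2C Ω) (g : Fin d → L2C Ω) : Prop :=
  ∀ φ : Eucl d → ℝ, ContDiff ℝ ∞ φ → HasCompactSupport φ → tsupport φ ⊆ Ω →
    ∀ i : Fin d,
      ∫ x in Ω, partialDeriv i φ x • v x = - ∫ x in Ω, φ x • g i x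

/-- `v ∈ H¹(Ω)`. -/
def MemH1 {d : ℕ} (Ω : Set (Eucl d)) (v : L2C Ω) : Prop :=
  ∃ g : Fin d → L2C Ω, IsWeakGrad Ω v g

open Classical in
/-- The weak gradient `∇v` of `v ∈ H¹(Ω)`; it is unique when `Ω` is open. -/
def weakGrad {d : ℕ} (Ω : Set (Eucl d)) (v : L2C Ω) : Fin d → L2C Ω :=
  if h : MemH1 Ω v then h.choose else 0

/-- The `H¹(Ω)`-norm `‖v‖_V = (‖v‖² + ‖∇v‖²)^{1/2}`. -/
def normH1 {d : ℕ} (Ω : Set (Eucl d)) (v : L2C Ω) : ℝ :=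
  Real.sqrt (‖v‖ ^ 2 + ∑ i, ‖weakGrad Ω v i‖ ^ 2)

/-- `v ∈ V`, that is, `v ∈ H¹(Ω)` and the trace of `v` vanishes on `Γ_D`.
The trace on the boundary is the continuous extension to `H¹(Ω)` of the restriction map
`φ ↦ φ|_{∂Ω}` of smooth functions, with values in `L²` of the surface (Hausdorff) measure; hence
the trace of `v` vanishes on `Γ_D` when smooth functions `φ_n` converge to `v` in `H¹(Ω)` while
their restrictions to `Γ_D` converge to `0` in `L²(Γ_D)`. -/
def MemV {d : ℕ} (Ω ΓD : Set (Eucl d)) (v : L2C Ω) : Prop :=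
  MemH1 Ω v ∧
  ∃ φ : ℕ → Eucl d → ℂ,
    (∀ n, ContDiff ℝ ∞ (φ n) ∧ HasCompactSupport (φ n)) ∧
    Tendsto (fun n => eLpNorm (fun x => φ n x - v x) 2 (volume.restrict Ω)) atTop (𝓝 0) ∧
    (∀ i : Fin d, Tendsto
      (fun n => eLpNorm (fun x => partialDeriv i (φ n) x - weakGrad Ω v i x) 2
        (volume.restrict Ω)) atTop (𝓝 0)) ∧
    Tendsto (fun n => eLpNorm (φ n) 2
      ((Measure.hausdorffMeasure ((d : ℝ) - 1)).restrict ΓD)) atTop (𝓝 0)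

/-! ## The sesquilinear form -/

/-- The integrand `∇w C(x) (conj ∇v)ᵀ + (a(x)·∇)w conj v + r(x) w conj v`. -/
def formIntegrand {d : ℕ} (Ω : Set (Eucl d))
    (Cm : Eucl d → Matrix (Fin d) (Fin d) ℂ) (a : Eucl d → Fin d → ℂ) (r : Eucl d → ℂ)
    (w v : L2C Ω) (x : Eucl d) : ℂ :=
  (∑ i, ∑ j, weakGrad Ω w i x * Cm x i j * star (weakGrad Ω v j x))
    + (∑ i, a x i * weakGrad Ω w i x) * star (v x)
    + r x * w x * star (v x)

/-- The sesquilinear form `A(w, v)`, linear in `w` and antilinear in `v`. -/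
def sesqForm {d : ℕ} (Ω : Set (Eucl d))
    (Cm : Eucl d → Matrix (Fin d) (Fin d) ℂ) (a : Eucl d → Fin d → ℂ) (r : Eucl d → ℂ)
    (w v : L2C Ω) : ℂ :=
  ∫ x in Ω, formIntegrand Ω Cm a r w v x

/-- The index of a form `A` with domain `D`: the smallest `β ≥ 0` such that
`|A_Im(v, v)| ≤ β A_Re(v, v)` for all `v ∈ D`. On the diagonal, the real and imaginary parts
`A_Re = (A + A^*)/2` and `A_Im = (A - A^*)/(2i)` of `A` take the values `Re A(v, v)` and
`Im A(v, v)`. -/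
def formIndex {X : Type*} (D : X → Prop) (A : X → X → ℂ) : ℝ :=
  sInf {β : ℝ | 0 ≤ β ∧ ∀ v, D v → |(A v v).im| ≤ β * (A v v).re}

/-! ## The discrete operator and its fractional power -/

/-- `B` is the discrete counterpart of the form `A` on `Vh`: `(B w, v) = A(w, v)` for all
`w, v ∈ Vh`, with the inner product of `X` (linear in its first argument in this notation;
Mathlib's `inner` is linear in its second argument). -/
def IsDiscreteOp {X : Type*} [NormedAddCommGroup X] [InnerProductSpace ℂ X]
    (A : X → X → ℂ) (Vh : Submodule ℂ X) (B : Vh →L[ℂ] Vh) : Prop :=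
  ∀ w v : Vh, inner ℂ v (B w) = A w v

open Classical in
/-- The discrete operator `A_h` on the finite-dimensional space `Vh`; it is unique. -/
def discreteOp {X : Type*} [NormedAddCommGroup X] [InnerProductSpace ℂ X]
    (A : X → X → ℂ) (Vh : Submodule ℂ X) : Vh →L[ℂ] Vh :=
  if h : ∃ B, IsDiscreteOp A Vh B then h.choose else 0

/-- The circle with centre `p.1` and radius `p.2` is an integration contour for the fractional
powers of `B`: it surrounds the spectrum of `B`, and it and its interior avoid the branch cut
`(-∞, 0]`. -/
def IsDunfordContour {W : Type*} [NormedAddCommGroup W] [NormedSpace ℂ W]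
    (B : W →L[ℂ] W) (p : ℂ × ℝ) : Prop :=
  0 < p.2 ∧ Metric.closedBall p.1 p.2 ⊆ Complex.slitPlane ∧ spectrum ℂ B ⊆ Metric.ball p.1 p.2

open Classical in
/-- The Dunford–Taylor fractional power `B^α = (1/(2πi)) ∮ z^α (z - B)⁻¹ dz` (principal branch)
of a bounded operator whose spectrum a contour as above surrounds; by Cauchy's theorem the
integral is the same for all such contours. A compact subset of the open right half-plane is
always surrounded by such a circle. -/
def dunfordPower {W : Type*} [NormedAddCommGroup W] [NormedSpace ℂ W]
    (α : ℝ) (B : W →L[ℂ] W) : W →L[ℂ] W :=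
  if h : ∃ p : ℂ × ℝ, IsDunfordContour B p then
    (2 * (Real.pi : ℂ) * Complex.I)⁻¹ •
      circleIntegral (fun z : ℂ => z ^ (α : ℂ) • resolvent B z) h.choose.1 h.choose.2
  else 0

/-- `B^α + b I`. -/
def shiftedPower {W : Type*} [NormedAddCommGroup W] [NormedSpace ℂ W]
    (α b : ℝ) (B : W →L[ℂ] W) : W →L[ℂ] W :=
  dunfordPower α B + (b : ℂ) • (1 : W →L[ℂ] W)

/-- The semidiscrete solution `u_h = (B^α + b I)⁻¹ f_h`. -/
def semidiscreteSol {W : Type*} [NormedAddCommGroup W] [NormedSpace ℂ W]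
    (α b : ℝ) (B : W →L[ℂ] W) (fh : W) : W :=
  Ring.inverse (shiftedPower α b B) fh

/-! ## The quadrature -/

/-- `1 + e^{-s/α} B`. -/
def resolventFactor {W : Type*} [NormedAddCommGroup W] [NormedSpace ℂ W]
    (α s : ℝ) (B : W →L[ℂ] W) : W →L[ℂ] W :=
  1 + ((Real.exp (-s / α) : ℝ) : ℂ) • B

/-- The integrand `(1 + e^{-s/α} B)⁻¹ f_h / (e^s + 2 b cos(πα) + b² e^{-s})`. -/
def quadIntegrand {W : Type*} [NormedAddCommGroup W] [NormedSpace ℂ W]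
    (α b : ℝ) (B : W →L[ℂ] W) (fh : W) (s : ℝ) : W :=
  (((Real.exp s + 2 * b * Real.cos (Real.pi * α) + b ^ 2 * Real.exp (-s))⁻¹ : ℝ) : ℂ) •
    Ring.inverse (resolventFactor α s B) fh

/-- The trapezoidal approximation
`u_{h,τ} = (sin(πα)/(απ)) τ ∑_{n ∈ ℤ} (1 + e^{-nτ/α} B)⁻¹ f_h / (e^{nτ} + 2b cos(πα) + b² e^{-nτ})`.
-/
def quadSol {W : Type*} [NormedAddCommGroup W] [NormedSpace ℂ W]
    (α b τ : ℝ) (B : W →L[ℂ] W) (fh : W) : W :=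
  ((Real.sin (Real.pi * α) / (α * Real.pi) * τ : ℝ) : ℂ) •
    ∑' n : ℤ, quadIntegrand α b B fh (n * τ)

/-- `κ₁ = α (π - arctan β)`. -/
def kappa1 (α β : ℝ) : ℝ := α * (Real.pi - Real.arctan β)

/-- `κ₂ = (1 - α) π`. -/
def kappa2 (α : ℝ) : ℝ := (1 - α) * Real.pi

open Classical in
/-- The factor `C(τ)`. -/
def quadFactor (α β τ : ℝ) : ℝ :=
  if kappa2 α < kappa1 α β then
    (Real.sin (min ((kappa1 α β - kappa2 α) / α + (1 - α) / α * τ) (Real.pi / 2)))⁻¹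
      * (1 + |Real.log τ|)
  else
    (Real.sin (min τ (Real.pi / 2)))⁻¹
      * (1 + |Real.log (kappa2 α - kappa1 α β + α * τ)|)

end

/-! ## Contour shifts in a strip and the trapezoidal rule -/

/-! The semidiscrete solution is an integral over the real line whose integrand extends
holomorphically to a strip, and the quadrature is the trapezoidal rule for that integral. For a
function holomorphic in `|Im z| ≤ d` with an integrable majorant `k`, Poisson summation and a
contour shift bound the error by `2 q / (1 - q) * ∫ k` with `q = exp(-2πd/τ)`
(`norm_integral_sub_trapezoid_le`). It remains to find the representation, the width of the strip,
and the growth of the majorant as the strip is widened.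

Representation. For scalar `λ = e^μ` the density `1/(e^s + 2b cos πα + b² e^{-s})` is, after `s =
αx` and up to a factor, the jump of `1/(e^{αζ} + b)` between the lines `Im ζ = ±π`. Integrating this
function against the `2πi`-periodic kernel `1/(1 - e^{μ-ζ})` over both lines picks up the residue at
`μ`, which is `1/(λ^α + b)` (`integral_log_variable`). Dunford integration over a circle and Fubini
carry the identity to operators (`IsSectorial.integral_smul_inverse_mul_shiftedPower`); this also
yields the invertibility of `B^α + b`.

Strip. Two things obstruct the extension. The scalar denominator is a product of two hyperbolic
sines with zeros at `log b ± iκ₂` (`quadDenom_eq_sinh_mul_sinh`); near them it costs a factor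
`1/(|x| + δ)`, where `δ` is proportional to `κ₂ - d`, and the integral of that factor is logarithmic
in `δ`. The inverse of `1 + e^{-z/α} B` is controlled by the numerical range of `B`, which lies in
the sector of half-angle `arctan β`: it exists for `|Im z| < κ₁` and has norm at most `1/sin γ`,
where `γ` is the remaining angle (`IsSectorial.sin_mul_norm_le`).

Balance. Taking `d` below `min(κ₁, κ₂)` by a multiple of `τ` loses only a constant in `exp(-2πd/τ)`,
while `δ` and `γ` stay positive; the factor `C(τ)` records the product of `1/sin γ` and the
logarithm in the two cases. All constants depend on `α` alone because the form enters only through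
its coercivity and its index (`IsSectorial`). -/

theorem continuous_line {F : ℂ → ℂ} {p q y : ℝ} (hy : y ∈ Set.Icc p q)
    (hd : DifferentiableOn ℂ F {z | z.im ∈ Set.Icc p q}) :
    Continuous fun x : ℝ => F (x + y * Complex.I) := by
  rw [← continuousOn_univ]
  refine hd.continuousOn.comp (by fun_prop) ?_
  intro x _
  simpa using hy

/-- Continuity takes care of the bounded part of the line, so decay is needed only for `|Re z| ≥ T`.
This freedom matters for kernels that are estimated only away from a pole. -/
theorem integrable_line {F : ℂ → ℂ} {p q y C T : ℝ} (hy : y ∈ Set.Icc p q)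
    (hd : DifferentiableOn ℂ F {z | z.im ∈ Set.Icc p q})
    (hb : ∀ z : ℂ, z.im ∈ Set.Icc p q → T ≤ |z.re| → ‖F z‖ ≤ C * (1 + z.re ^ 2)⁻¹) :
    Integrable fun x : ℝ => F (x + y * Complex.I) := by
  have hO : ∀ l : Filter ℝ, (∀ᶠ x in l, T ≤ |x|) →
      (fun x : ℝ => F (x + y * Complex.I)) =O[l] fun x : ℝ => (1 + x ^ 2)⁻¹ := by
    intro l hl
    refine Asymptotics.IsBigO.of_bound C ?_
    filter_upwards [hl] with x hx
    have h := hb (x + y * Complex.I) (by simpa using hy) (by simpa using hx)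
    rw [Real.norm_of_nonneg (by positivity)]
    simpa using h
  refine LocallyIntegrable.integrable_of_isBigO_atBot_atTop
    (continuous_line hy hd).locallyIntegrable
    (hO _ (tendsto_abs_atBot_atTop.eventually_ge_atTop T))
    (integrable_inv_one_add_sq.integrableAtFilter _)
    (hO _ (tendsto_abs_atTop_atTop.eventually_ge_atTop T))
    (integrable_inv_one_add_sq.integrableAtFilter _)

theorem tendsto_vertical_integral {F : ℂ → ℂ} {p q C T : ℝ} (hpq : p ≤ q)
    (hb : ∀ z : ℂ, z.im ∈ Set.Icc p q → T ≤ |z.re| → ‖F z‖ ≤ C * (1 + z.re ^ 2)⁻¹)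
    {u : ℝ → ℝ} (hu : Tendsto (fun R => |u R|) atTop atTop) :
    Tendsto (fun R : ℝ => ∫ y in p..q, F (u R + y * Complex.I)) atTop (𝓝 0) := by
  have h1 : Tendsto (fun R : ℝ => C * (1 + u R ^ 2)⁻¹ * |q - p|) atTop (𝓝 0) := by
    have h2 : Tendsto (fun R : ℝ => 1 + u R ^ 2) atTop atTop := by
      refine tendsto_atTop_add_const_left _ _ ?_
      have := (tendsto_pow_atTop (α := ℝ) two_ne_zero).comp hu
      refine this.congr fun R => ?_
      simp
    simpa using (h2.inv_tendsto_atTop.const_mul C).mul_const |q - p|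
  refine squeeze_zero_norm' ?_ h1
  filter_upwards [hu.eventually_ge_atTop T] with R hR
  refine intervalIntegral.norm_integral_le_of_norm_le_const fun y hy => ?_
  rw [Set.uIoc_of_le hpq] at hy
  simpa using hb (u R + y * Complex.I) (by simpa using ⟨hy.1.le, hy.2⟩) (by simpa using hR)

/-- The integral of a holomorphic function over a horizontal line does not depend on the line,
as long as the function decays quadratically in the strip. -/
theorem integral_line_eq_integral_line {F : ℂ → ℂ} {p q C T : ℝ} (hpq : p ≤ q)
    (hd : DifferentiableOn ℂ F {z | z.im ∈ Set.Icc p q})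
    (hb : ∀ z : ℂ, z.im ∈ Set.Icc p q → T ≤ |z.re| → ‖F z‖ ≤ C * (1 + z.re ^ 2)⁻¹) :
    ∫ x : ℝ, F (x + p * Complex.I) = ∫ x : ℝ, F (x + q * Complex.I) := by
  have hline : ∀ y ∈ Set.Icc p q, Tendsto (fun R : ℝ => ∫ x in (-R)..R, F (x + y * Complex.I))
      atTop (𝓝 (∫ x : ℝ, F (x + y * Complex.I))) := fun y hy =>
    intervalIntegral_tendsto_integral (integrable_line hy hd hb) tendsto_neg_atTop_atBot tendsto_id
  have hv1 := (tendsto_vertical_integral hpq hb (u := fun R => R)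
    tendsto_abs_atTop_atTop).const_smul Complex.I
  have hv2 := (tendsto_vertical_integral hpq hb (u := fun R => -R)
    (by simpa using tendsto_abs_atTop_atTop)).const_smul Complex.I
  have hp := hline p ⟨le_rfl, hpq⟩
  have hq := hline q ⟨hpq, le_rfl⟩
  have hlim := ((hp.sub hq).add hv1).sub hv2
  have hzero : ∀ R : ℝ, (∫ x in (-R)..R, F (x + p * Complex.I)) -
      (∫ x in (-R)..R, F (x + q * Complex.I)) +
      Complex.I • (∫ y in p..q, F (R + y * Complex.I)) -
      Complex.I • (∫ y in p..q, F ((-R : ℝ) + y * Complex.I)) = 0 := by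
    intro R
    have := Complex.integral_boundary_rect_eq_zero_of_differentiableOn F
      (⟨-R, p⟩ : ℂ) (⟨R, q⟩ : ℂ) (hd.mono ?_)
    · exact this
    · rintro z ⟨-, hz⟩
      simpa [Set.uIcc_of_le hpq] using hz
  simp only [hzero, smul_zero, add_zero, sub_zero] at hlim
  exact (sub_eq_zero.mp (tendsto_nhds_unique hlim tendsto_const_nhds)).trans rfl

theorem norm_exp_mul_I (a : ℝ) (z : ℂ) : ‖Complex.exp (a * z * Complex.I)‖ = Real.exp (-a * z.im) := by
  rw [Complex.norm_exp]; simp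

/-- Exponential decay of the Fourier transform of a function that is holomorphic in a strip. -/
theorem norm_fourier_integral_le_of_strip {g : ℂ → ℂ} {d C a : ℝ} {k : ℝ → ℝ} (hd0 : 0 ≤ d)
    (hd : DifferentiableOn ℂ g {z | z.im ∈ Set.Icc (-d) d})
    (hk : Integrable k) (hkC : ∀ x, k x ≤ C * (1 + x ^ 2)⁻¹)
    (hb : ∀ z : ℂ, z.im ∈ Set.Icc (-d) d → ‖g z‖ ≤ k z.re) :
    ‖∫ x : ℝ, Complex.exp (a * x * Complex.I) * g x‖ ≤ Real.exp (-|a| * d) * ∫ x, k x := by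
  have hC : 0 ≤ C := by
    have := (norm_nonneg _).trans ((hb 0 (by simpa using hd0)).trans (hkC _))
    simpa using this
  set F : ℂ → ℂ := fun z => Complex.exp (a * z * Complex.I) * g z with hF
  have hFd : DifferentiableOn ℂ F {z | z.im ∈ Set.Icc (-d) d} := by
    refine DifferentiableOn.mul (Differentiable.differentiableOn (by fun_prop)) hd
  have hFb : ∀ z : ℂ, z.im ∈ Set.Icc (-d) d → (0:ℝ) ≤ |z.re| →
      ‖F z‖ ≤ (Real.exp (|a| * d) * C) * (1 + z.re ^ 2)⁻¹ := by
    intro z hz _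
    rw [hF]
    simp only [norm_mul, norm_exp_mul_I]
    rw [mul_assoc]
    refine mul_le_mul (Real.exp_le_exp.2 ?_) ((hb z hz).trans (hkC _)) (norm_nonneg _)
      (Real.exp_pos _).le
    calc -a * z.im ≤ |-a * z.im| := le_abs_self _
      _ = |a| * |z.im| := by rw [abs_mul, abs_neg]
      _ ≤ |a| * d := by gcongr; exact abs_le.2 hz
  have hline : ∀ y ∈ Set.Icc (-d) d, ∫ x : ℝ, F (x + y * Complex.I) = ∫ x : ℝ, F x := by
    intro y hy
    have h1 := integral_line_eq_integral_line (p := -d) (q := y) hy.1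
      (hFd.mono fun z hz => ⟨hz.1, hz.2.trans hy.2⟩)
      (fun z hz => hFb z ⟨hz.1, hz.2.trans hy.2⟩)
    have h2 := integral_line_eq_integral_line (p := -d) (q := 0) (by linarith)
      (hFd.mono fun z hz => ⟨hz.1, hz.2.trans hd0⟩)
      (fun z hz => hFb z ⟨hz.1, hz.2.trans hd0⟩)
    rw [← h1, h2]
    simp
  -- On the line `Im z = y` the exponential has modulus `e^{-ay}`; the edge of the strip on the side
  -- given by the sign of `a` yields the decay.
  have key : ∀ y ∈ Set.Icc (-d) d, a * y = |a| * d →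
      ‖∫ x : ℝ, F x‖ ≤ Real.exp (-|a| * d) * ∫ x, k x := by
    intro y hy hay
    rw [← hline y hy, ← integral_const_mul]
    refine norm_integral_le_of_norm_le (hk.const_mul _) (Eventually.of_forall fun x => ?_)
    simp only [hF, norm_mul, norm_exp_mul_I]
    have h := hb (x + y * Complex.I) (by simpa using hy)
    have e1 : (x + y * Complex.I : ℂ).im = y := by simp
    have e2 : (x + y * Complex.I : ℂ).re = x := by simp
    rw [e2] at h
    rw [e1, neg_mul, hay, ← neg_mul]
    gcongr
  rcases le_total 0 a with h | h
  · exact key d ⟨by linarith, le_rfl⟩ (by rw [abs_of_nonneg h])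
  · exact key (-d) ⟨le_rfl, by linarith⟩ (by rw [abs_of_nonpos h]; ring)

/-- Two equal geometric tails, one for each sign: the majorant for the nonzero frequencies in
Poisson summation. -/
theorem hasSum_int_pow_natAbs_erase {r : ℝ} (h0 : 0 ≤ r) (h1 : r < 1) :
    HasSum (fun n : ℤ => if n = 0 then 0 else r ^ n.natAbs) (2 * (r / (1 - r))) := by
  have hg := (hasSum_geometric_of_lt_one h0 h1).mul_left r
  have e : r * (1 - r)⁻¹ = r / (1 - r) := by rw [div_eq_mul_inv]
  rw [e] at hg
  have h := HasSum.of_nat_of_neg_add_one (f := fun n : ℤ => if n = 0 then 0 else r ^ n.natAbs)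
    (m := r / (1 - r)) (m' := r / (1 - r)) ?_ ?_
  · rwa [two_mul]
  · rw [← hasSum_nat_add_iff' 1]
    have e2 : (fun n : ℕ => if ((n + 1 : ℕ) : ℤ) = 0 then 0 else r ^ (((n + 1 : ℕ) : ℤ)).natAbs) =
        fun n : ℕ => r * r ^ n := by
      ext n
      rw [if_neg (by omega), Int.natAbs_natCast, pow_succ']
    rw [e2]
    simpa using hg
  · have e2 : (fun n : ℕ => if (-((n : ℤ) + 1)) = 0 then 0 else r ^ (-((n : ℤ) + 1)).natAbs) =
        fun n : ℕ => r * r ^ n := by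
      ext n
      have : (-((n : ℤ) + 1)).natAbs = n + 1 := by omega
      rw [if_neg (by omega), this, pow_succ']
    simpa only [e2] using hg

theorem isBigO_of_le_inv {f : ℝ → ℂ} {C : ℝ} (h : ∀ x, ‖f x‖ ≤ C * (1 + x ^ 2)⁻¹) :
    f =O[cocompact ℝ] fun x : ℝ => |x| ^ (-2 : ℝ) := by
  have hC : 0 ≤ C := by simpa using (norm_nonneg _).trans (h 0)
  refine Asymptotics.IsBigO.of_bound C ?_
  have hne : ∀ᶠ x : ℝ in cocompact ℝ, x ≠ 0 := by
    have := (isCompact_singleton (x := (0:ℝ))).compl_mem_cocompact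
    filter_upwards [this] with x hx using hx
  filter_upwards [hne] with x hx
  rw [Real.norm_of_nonneg (by positivity), Real.rpow_neg (abs_nonneg x), Real.rpow_two, sq_abs]
  refine (h x).trans ?_
  gcongr
  linarith

theorem summable_int_mul_of_le_inv {E : Type*} [NormedAddCommGroup E] [CompleteSpace E]
    {f : ℝ → E} {C τ : ℝ} (hτ : 0 < τ) (h : ∀ x, ‖f x‖ ≤ C * (1 + x ^ 2)⁻¹) :
    Summable fun n : ℤ => f (n * τ) := by
  have hC : 0 ≤ C := by simpa using (norm_nonneg _).trans (h 0)
  have h2 : Summable fun n : ℤ => C * (τ ^ 2)⁻¹ * (1 / (n : ℝ) ^ 2) :=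
    (Real.summable_one_div_int_pow.2 one_lt_two).mul_left _
  refine Summable.of_norm_bounded_eventually h2 ?_
  have hne : ∀ᶠ n : ℤ in cofinite, n ≠ 0 := by
    rw [Filter.eventually_cofinite]
    simp
  filter_upwards [hne] with n hn
  refine (h _).trans ?_
  rw [one_div, mul_assoc, ← mul_inv]
  have : (n : ℝ) ≠ 0 := by exact_mod_cast hn
  gcongr
  nlinarith

/-- The error of the trapezoidal rule for a function that is holomorphic in a strip. -/
theorem norm_integral_sub_trapezoid_le {g : ℂ → ℂ} {d C τ : ℝ} {k : ℝ → ℝ} (hd0 : 0 < d)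
    (hτ : 0 < τ)
    (hd : DifferentiableOn ℂ g {z | z.im ∈ Set.Icc (-d) d})
    (hk : Integrable k) (hkC : ∀ x, k x ≤ C * (1 + x ^ 2)⁻¹)
    (hb : ∀ z : ℂ, z.im ∈ Set.Icc (-d) d → ‖g z‖ ≤ k z.re) :
    ‖(∫ x : ℝ, g x) - τ * ∑' n : ℤ, g ((n * τ : ℝ) : ℂ)‖ ≤
      2 * (Real.exp (-2 * Real.pi * d / τ) / (1 - Real.exp (-2 * Real.pi * d / τ))) *
        ∫ x, k x := by
  set r := Real.exp (-2 * Real.pi * d / τ) with hr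
  have hr1 : r < 1 := by
    rw [hr, Real.exp_lt_one_iff]
    have := Real.pi_pos
    have : 0 < 2 * Real.pi * d / τ := by positivity
    have e : -2 * Real.pi * d / τ = -(2 * Real.pi * d / τ) := by ring
    linarith
  have hC : 0 ≤ C := by
    simpa using (norm_nonneg _).trans ((hb 0 (by simpa using hd0.le)).trans (hkC _))
  have hgb : ∀ x : ℝ, ‖g x‖ ≤ C * (1 + x ^ 2)⁻¹ := fun x => by
    simpa using (hb x (by simpa using hd0.le)).trans (hkC _)
  set f : ℝ → ℂ := fun x => g ((x * τ : ℝ) : ℂ) with hf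
  -- The rescaled function `f` has Fourier transform `J n / τ` at `n`, so Poisson summation turns `τ
  -- ∑ g(nτ)` into `∑ J n`. Since `J 0 = ∫ g`, the error is the sum over `n ≠ 0`.
  set J : ℤ → ℂ := fun n => ∫ x : ℝ, Complex.exp ((-2 * Real.pi * n / τ : ℝ) * x * Complex.I) * g x
    with hJ
  have hfour : ∀ n : ℤ, FourierTransform.fourier f (n : ℝ) = (τ : ℂ)⁻¹ * J n := by
    intro n
    rw [Real.fourier_real_eq_integral_exp_smul]
    have := Measure.integral_comp_mul_right
      (fun x : ℝ => Complex.exp ((-2 * Real.pi * n / τ : ℝ) * x * Complex.I) * g x) τ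
    simp only [hJ]
    rw [abs_of_pos (inv_pos.2 hτ), Complex.real_smul, Complex.ofReal_inv] at this
    rw [← this]
    congr 1
    ext v
    rw [smul_eq_mul, hf]
    congr 3
    rw [← Complex.ofReal_mul]
    congr 1
    field_simp
  have hJb : ∀ n : ℤ, ‖J n‖ ≤ r ^ n.natAbs * ∫ x, k x := by
    intro n
    refine (norm_fourier_integral_le_of_strip hd0.le hd hk hkC hb).trans_eq ?_
    congr 1
    rw [hr, ← Real.exp_nat_mul]
    congr 1
    have : |(-2 * Real.pi * n / τ : ℝ)| = 2 * Real.pi * (n.natAbs : ℝ) / τ := by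
      rw [abs_div, abs_mul, abs_mul, abs_neg, abs_of_pos hτ, abs_of_pos Real.pi_pos,
        Nat.cast_natAbs, Int.cast_abs]
      simp
    rw [this]; ring
  have hsJ0 := (hasSum_int_pow_natAbs_erase (Real.exp_pos _).le hr1).mul_right (∫ x, k x)
  have hJb' : ∀ n : ℤ, ‖if n = 0 then 0 else J n‖ ≤
      (if n = 0 then 0 else r ^ n.natAbs) * ∫ x, k x := by
    intro n
    split_ifs
    · simp
    · exact hJb n
  have hsJ' : Summable fun n : ℤ => if n = 0 then 0 else J n :=
    Summable.of_norm_bounded hsJ0.summable hJb'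
  have hsplit : ∀ n : ℤ, J n = (if n = 0 then 0 else J n) + (if n = 0 then J 0 else 0) := by
    intro n
    split_ifs with h <;> simp [h]
  have hs0 : HasSum (fun n : ℤ => if n = 0 then J 0 else 0) (J 0) := by
    simpa using hasSum_ite_eq (0 : ℤ) (J 0)
  have hsJ : HasSum J ((∑' n : ℤ, if n = 0 then 0 else J n) + J 0) := by
    have := hsJ'.hasSum.add hs0
    rwa [← funext hsplit] at this
  have hJ0 : J 0 = ∫ x : ℝ, g x := by simp [hJ]
  have hcont : Continuous f := by
    have := continuous_line (y := 0) (by simpa using hd0.le) hd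
    simp only [Complex.ofReal_zero, zero_mul, add_zero] at this
    exact this.comp (by fun_prop : Continuous fun x : ℝ => x * τ)
  -- The constant comes from `1 + x² ≤ max(1, τ⁻²) (1 + τ²x²)`.
  have hfb : ∀ x, ‖f x‖ ≤ C * max 1 (τ ^ 2)⁻¹ * (1 + x ^ 2)⁻¹ := by
    intro x
    refine (hgb _).trans ?_
    rw [mul_assoc]
    gcongr
    rw [inv_le_iff_one_le_mul₀ (by positivity), mul_comm, ← mul_assoc, ← div_eq_mul_inv,
      one_le_div (by positivity)]
    have h1 : 1 ≤ max 1 (τ ^ 2)⁻¹ := le_max_left _ _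
    have h2 : (τ ^ 2)⁻¹ ≤ max 1 (τ ^ 2)⁻¹ := le_max_right _ _
    have h3 : 1 ≤ τ ^ 2 * max 1 (τ ^ 2)⁻¹ := by
      calc (1:ℝ) = τ ^ 2 * (τ ^ 2)⁻¹ := by field_simp
        _ ≤ _ := by gcongr
    nlinarith [sq_nonneg x]
  have hP := Real.tsum_eq_tsum_fourier_of_rpow_decay_of_summable hcont one_lt_two
    (isBigO_of_le_inv hfb) (by simpa only [hfour] using hsJ.summable.mul_left _) 0
  simp only [hfour, zero_add, QuotientAddGroup.mk_zero, fourier_eval_zero, mul_one,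
    tsum_mul_left] at hP
  have hτ' : (τ : ℂ) ≠ 0 := by exact_mod_cast hτ.ne'
  have hfin : (∫ x : ℝ, g x) - τ * ∑' n : ℤ, g ((n * τ : ℝ) : ℂ) =
      -∑' n : ℤ, if n = 0 then 0 else J n := by
    change (∫ x : ℝ, g x) - τ * ∑' n : ℤ, f n = _
    rw [hP, hsJ.tsum_eq, hJ0, ← mul_assoc, mul_inv_cancel₀ hτ']
    ring
  rw [hfin, norm_neg]
  exact tsum_of_norm_bounded hsJ0 hJb'

/-! ## The scalar integral representation -/

/-- Follows from `e^t ≥ 1 + t²/2`. It converts exponential decay into the quadratic decay that the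
contour lemmas take as input. -/
theorem exp_neg_mul_abs_le {c : ℝ} (hc : 0 < c) (x : ℝ) :
    Real.exp (-c * |x|) ≤ max 1 (2 / c ^ 2) * (1 + x ^ 2)⁻¹ := by
  have h1 : 1 + (c * |x|) ^ 2 / 2 ≤ Real.exp (c * |x|) := by
    have := Real.quadratic_le_exp_of_nonneg (x := c * |x|) (by positivity)
    have : 0 ≤ c * |x| := by positivity
    linarith
  have h2 : 1 ≤ max 1 (2 / c ^ 2) := le_max_left _ _
  have h3 : 1 ≤ c ^ 2 / 2 * max 1 (2 / c ^ 2) := by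
    calc (1:ℝ) = c ^ 2 / 2 * (2 / c ^ 2) := by field_simp
      _ ≤ _ := by gcongr; exact le_max_right _ _
  rw [neg_mul, Real.exp_neg, ← div_eq_mul_inv, inv_le_iff_one_le_mul₀ (Real.exp_pos _),
    div_mul_eq_mul_div, one_le_div (by positivity)]
  rw [mul_pow, sq_abs] at h1
  calc 1 + x ^ 2 ≤ max 1 (2 / c ^ 2) + (c ^ 2 / 2 * max 1 (2 / c ^ 2)) * x ^ 2 := by
        gcongr; nlinarith [sq_nonneg x]
    _ = max 1 (2 / c ^ 2) * (1 + c ^ 2 * x ^ 2 / 2) := by ring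
    _ ≤ _ := by gcongr

/-- The kernel `1 / (2 sinh (u / 2))`. -/
noncomputable def sinhKernel (u : ℂ) : ℂ := (Complex.exp (u / 2) - Complex.exp (-(u / 2)))⁻¹

/-- A zero would give `e^u = 1`, hence `u ∈ 2πiℤ`, and the bound on the imaginary part leaves only
`u = 0`. -/
theorem exp_half_sub_ne_zero {u : ℂ} (h1 : |u.im| < 2 * Real.pi) (h0 : u ≠ 0) :
    Complex.exp (u / 2) - Complex.exp (-(u / 2)) ≠ 0 := by
  intro h
  have h2 : Complex.exp u = 1 := by
    have e : u = u / 2 + u / 2 := by ring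
    rw [e, Complex.exp_add]
    nth_rewrite 1 [sub_eq_zero.1 h]
    rw [← Complex.exp_add, neg_add_cancel, Complex.exp_zero]
  obtain ⟨n, hn⟩ := Complex.exp_eq_one_iff.1 h2
  have him : u.im = n * (2 * Real.pi) := by rw [hn]; simp
  have hpi := Real.pi_pos
  rw [him, abs_mul, abs_of_pos (by positivity : 0 < 2 * Real.pi)] at h1
  have : |(n : ℝ)| < 1 := by nlinarith
  have hn0 : n = 0 := by
    have : |n| < 1 := by exact_mod_cast this
    exact Int.abs_lt_one_iff.1 this
  exact h0 (by simp [hn, hn0])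

theorem norm_sinhKernel_le {u : ℂ} (h : 1 ≤ |u.re|) :
    ‖sinhKernel u‖ ≤ 2 * Real.exp (-(|u.re| / 2)) := by
  have h1 : Real.exp (|u.re| / 2) - Real.exp (-(|u.re| / 2)) ≤
      ‖Complex.exp (u / 2) - Complex.exp (-(u / 2))‖ := by
    have e1 : ‖Complex.exp (u / 2)‖ = Real.exp (u.re / 2) := by simp [Complex.norm_exp]
    have e2 : ‖Complex.exp (-(u / 2))‖ = Real.exp (-(u.re / 2)) := by simp [Complex.norm_exp]
    rcases le_total 0 u.re with h0 | h0
    · rw [abs_of_nonneg h0, ← e1, ← e2]; exact norm_sub_norm_le _ _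
    · rw [abs_of_nonpos h0, norm_sub_rev, neg_div, neg_neg, ← e1, ← e2]
      exact norm_sub_norm_le _ _
  -- Here `|Re u| ≥ 1` enters, through `e^{|Re u|} ≥ 2`: the smaller exponential is at most half the
  -- larger one.
  have h2 : Real.exp (-(|u.re| / 2)) ≤ Real.exp (|u.re| / 2) / 2 := by
    have h3 : Real.exp (|u.re| / 2) = Real.exp |u.re| * Real.exp (-(|u.re| / 2)) := by
      rw [← Real.exp_add]; congr 1; ring
    have h4 : 2 ≤ Real.exp |u.re| := by
      have := Real.add_one_le_exp |u.re|; linarith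
    rw [h3]
    have := Real.exp_pos (-(|u.re| / 2))
    nlinarith
  rw [sinhKernel, norm_inv]
  have h5 : Real.exp (|u.re| / 2) / 2 ≤ ‖Complex.exp (u / 2) - Complex.exp (-(u / 2))‖ := by linarith
  calc _ ≤ (Real.exp (|u.re| / 2) / 2)⁻¹ := by gcongr
    _ = _ := by rw [Real.exp_neg, inv_div, div_eq_mul_inv]

theorem norm_sinhKernel_le_inv (u : ℂ) (h : 1 ≤ |u.re|) :
    ‖sinhKernel u‖ ≤ (2 * max 1 (2 / (1 / 2) ^ 2)) * (1 + u.re ^ 2)⁻¹ := by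
  refine (norm_sinhKernel_le h).trans ?_
  have := exp_neg_mul_abs_le (c := 1 / 2) (by norm_num) u.re
  rw [mul_assoc]
  gcongr
  refine le_trans (le_of_eq ?_) this
  congr 1; ring

theorem differentiableOn_sinhKernel {p q : ℝ} (hp : -(2 * Real.pi) < p) (hq : q < 0) :
    DifferentiableOn ℂ sinhKernel {z | z.im ∈ Set.Icc p q} := by
  intro z hz
  have hz1 : p ≤ z.im := hz.1
  have hz2 : z.im ≤ q := hz.2
  have hpi := Real.pi_pos
  have hne := exp_half_sub_ne_zero (u := z) (by rw [abs_lt]; constructor <;> linarith)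
    (by rintro rfl; simp at hz2; linarith)
  have hd : DifferentiableAt ℂ (fun u : ℂ => Complex.exp (u / 2) - Complex.exp (-(u / 2))) z := by
    fun_prop
  exact (hd.inv hne).differentiableWithinAt

theorem tendsto_exp_half_atTop : Tendsto (fun x : ℝ => Real.exp (x / 2)) atTop atTop :=
  Real.tendsto_exp_atTop.comp (tendsto_id.atTop_div_const (by norm_num))

/-- On this line the kernel is `i / (2 cosh(x/2))`, which has the explicit primitive `2i
arctan(e^{x/2})`. -/
theorem integral_sinhKernel_neg_pi :
    ∫ x : ℝ, sinhKernel (x + (-Real.pi : ℝ) * Complex.I) = Real.pi * Complex.I := by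
  have hpi := Real.pi_pos
  have hI : Complex.exp ((Real.pi : ℂ) / 2 * Complex.I) = Complex.I := Complex.exp_pi_div_two_mul_I
  have hk : ∀ x : ℝ, sinhKernel (x + (-Real.pi : ℝ) * Complex.I) =
      Complex.I * (((Real.exp (x / 2) + Real.exp (-(x / 2)))⁻¹ : ℝ) : ℂ) := by
    intro x
    have e1 : ((x : ℂ) + (-Real.pi : ℝ) * Complex.I) / 2 =
        ((x / 2 : ℝ) : ℂ) - (Real.pi : ℂ) / 2 * Complex.I := by push_cast; ring
    have hIinv : Complex.exp (-((Real.pi : ℂ) / 2 * Complex.I)) = -Complex.I := by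
      rw [Complex.exp_neg, hI, Complex.inv_I]
    have e3 : -(((x / 2 : ℝ) : ℂ) - (Real.pi : ℂ) / 2 * Complex.I) =
        ((-(x / 2) : ℝ) : ℂ) + (Real.pi : ℂ) / 2 * Complex.I := by push_cast; ring
    rw [sinhKernel, e1, e3, sub_eq_add_neg ((x / 2 : ℝ) : ℂ), Complex.exp_add, Complex.exp_add, hI,
      hIinv, ← Complex.ofReal_exp, ← Complex.ofReal_exp]
    have e2 : (Real.exp (x / 2) : ℂ) * -Complex.I - (Real.exp (-(x / 2)) : ℂ) * Complex.I =
      -Complex.I * ((Real.exp (x / 2) + Real.exp (-(x / 2)) : ℝ) : ℂ) := by push_cast; ring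
    rw [e2, mul_inv, inv_neg, Complex.inv_I, neg_neg, Complex.ofReal_inv]
  have hint : Integrable fun x : ℝ => (Real.exp (x / 2) + Real.exp (-(x / 2)))⁻¹ := by
    have h := integrable_line (y := -Real.pi) (p := -Real.pi) (q := -Real.pi) (by simp)
      (differentiableOn_sinhKernel (by linarith) (by linarith))
      (fun z _ hz => norm_sinhKernel_le_inv z hz)
    refine h.norm.congr (Eventually.of_forall fun x => ?_)
    simp only [hk]
    rw [norm_mul, Complex.norm_I, one_mul, Complex.norm_real, Real.norm_of_nonneg (by positivity)]
  have hreal : ∫ x : ℝ, (Real.exp (x / 2) + Real.exp (-(x / 2)))⁻¹ = Real.pi := by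
    have hd : ∀ x : ℝ, HasDerivAt (fun x => 2 * Real.arctan (Real.exp (x / 2)))
        ((Real.exp (x / 2) + Real.exp (-(x / 2)))⁻¹) x := by
      intro x
      have h1 := (((hasDerivAt_id x).div_const 2).exp.arctan).const_mul 2
      have e : (Real.exp (x / 2) + Real.exp (-(x / 2)))⁻¹ =
          2 * (1 / (1 + Real.exp (x / 2) ^ 2) * (Real.exp (x / 2) * (1 / 2))) := by
        rw [Real.exp_neg]
        field_simp
        ring
      rw [e]
      exact h1
    rw [integral_of_hasDerivAt_of_tendsto hd hint (m := 0) (n := Real.pi)]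
    · simp
    · have h1 : Tendsto (fun x : ℝ => Real.exp (x / 2)) atBot (𝓝 0) :=
        Real.tendsto_exp_atBot.comp (tendsto_id.atBot_div_const (by norm_num))
      have := ((Real.continuous_arctan.tendsto 0).comp h1).const_mul 2
      simpa using this
    · have := ((Real.tendsto_arctan_atTop.mono_right nhdsWithin_le_nhds).comp
        tendsto_exp_half_atTop).const_mul 2
      rwa [mul_div_cancel₀ Real.pi two_ne_zero] at this
  simp only [hk]
  rw [integral_const_mul, integral_complex_ofReal, hreal, mul_comm]

/-- The poles of the kernel lie in `2πiℤ`, so every line with `-2π < y < 0` can be moved to `y =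
-π`. This value replaces a residue computation later on. -/
theorem integral_sinhKernel_line {y : ℝ} (h1 : -(2 * Real.pi) < y) (h2 : y < 0) (a : ℝ) :
    ∫ x : ℝ, sinhKernel ((x - a : ℝ) + y * Complex.I) = Real.pi * Complex.I := by
  have hpi := Real.pi_pos
  rw [integral_sub_right_eq_self (fun x : ℝ => sinhKernel (x + y * Complex.I)) a,
    ← integral_sinhKernel_neg_pi]
  have hb : ∀ p q : ℝ, ∀ z : ℂ, z.im ∈ Set.Icc p q → 1 ≤ |z.re| → ‖sinhKernel z‖ ≤
    (2 * max 1 (2 / (1 / 2) ^ 2)) * (1 + z.re ^ 2)⁻¹ := fun _ _ z _ hz => norm_sinhKernel_le_inv z hz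
  rcases le_total y (-Real.pi) with h | h
  · exact integral_line_eq_integral_line h (differentiableOn_sinhKernel h1 (by linarith)) (hb _ _)
  · exact (integral_line_eq_integral_line h (differentiableOn_sinhKernel (by linarith) h2)
      (hb _ _)).symm

/-! ### The function `1/(e^{αζ} + b)` and the removal of the pole at `μ`. -/

theorem exp_add_ofReal_ne_zero {w : ℂ} (hw : |w.im| < Real.pi) {b : ℝ} (hb : 0 < b) :
    Complex.exp w + b ≠ 0 := by
  intro h
  rw [abs_lt] at hw
  have h1 := Complex.log_exp hw.1 hw.2.le
  have h2 : Complex.exp w = ((-b : ℝ) : ℂ) := by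
    rw [Complex.ofReal_neg]; exact eq_neg_of_add_eq_zero_left h
  have h3 : (Complex.log (Complex.exp w)).im = Real.pi := by
    rw [h2, Complex.log_im, Complex.arg_ofReal_of_neg (by linarith)]
  rw [h1] at h3
  linarith

/-- The function `1 / (e^{αζ} + b)`. -/
noncomputable def fermiKernel (α b : ℝ) (ζ : ℂ) : ℂ := (Complex.exp (α * ζ) + b)⁻¹

theorem norm_fermiKernel_le_pos {α b : ℝ} (hb : 0 < b) {ζ : ℂ}
    (h : 2 * b ≤ Real.exp (α * ζ.re)) :
    ‖fermiKernel α b ζ‖ ≤ 2 * Real.exp (-(α * ζ.re)) := by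
  have e1 : ‖Complex.exp (α * ζ)‖ = Real.exp (α * ζ.re) := by simp [Complex.norm_exp]
  have h1 : Real.exp (α * ζ.re) / 2 ≤ ‖Complex.exp (α * ζ) + b‖ := by
    have := norm_sub_norm_le (Complex.exp (α * ζ)) (-(b : ℂ))
    rw [norm_neg, Complex.norm_real, Real.norm_of_nonneg hb.le, e1, sub_neg_eq_add] at this
    linarith
  rw [fermiKernel, norm_inv]
  calc _ ≤ (Real.exp (α * ζ.re) / 2)⁻¹ := by gcongr
    _ = _ := by rw [Real.exp_neg, inv_div, div_eq_mul_inv]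

theorem norm_fermiKernel_le_neg {α b : ℝ} (hb : 0 < b) {ζ : ℂ}
    (h : Real.exp (α * ζ.re) ≤ b / 2) : ‖fermiKernel α b ζ‖ ≤ 2 / b := by
  have e1 : ‖Complex.exp (α * ζ)‖ = Real.exp (α * ζ.re) := by simp [Complex.norm_exp]
  have h1 : b / 2 ≤ ‖Complex.exp (α * ζ) + b‖ := by
    have := norm_sub_norm_le (b : ℂ) (-Complex.exp (α * ζ))
    rw [norm_neg, Complex.norm_real, Real.norm_of_nonneg hb.le, e1, sub_neg_eq_add, add_comm] at this
    linarith
  rw [fermiKernel, norm_inv]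
  calc _ ≤ (b / 2)⁻¹ := by gcongr
    _ = _ := by rw [inv_div]

/-- Away from the pole at `μ`, this is
`(e^{(ζ-μ)/2} / (e^{αζ} + b) - 1 / (e^{αμ} + b)) / (2 sinh ((ζ-μ)/2))`. -/
noncomputable def regularizedKernel (α b : ℝ) (μ ζ : ℂ) : ℂ :=
  dslope (fun ζ => Complex.exp ((ζ - μ) / 2) * fermiKernel α b ζ - fermiKernel α b μ) μ ζ /
    dslope (fun ζ => Complex.exp ((ζ - μ) / 2) - Complex.exp (-((ζ - μ) / 2))) μ ζ

theorem regularizedKernel_of_ne {α b : ℝ} {μ ζ : ℂ} (h : ζ ≠ μ) :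
    regularizedKernel α b μ ζ =
      Complex.exp ((ζ - μ) / 2) * sinhKernel (ζ - μ) * fermiKernel α b ζ -
        fermiKernel α b μ * sinhKernel (ζ - μ) := by
  have h' : ζ - μ ≠ 0 := sub_ne_zero.2 h
  rw [regularizedKernel, dslope_of_ne _ h, dslope_of_ne _ h, slope_def_field, slope_def_field]
  simp only [sub_self, zero_div, Complex.exp_zero, one_mul, neg_zero, sub_zero]
  rw [div_div_div_cancel_right₀ h', div_eq_mul_inv, sinhKernel]
  ring

theorem differentiableOn_fermiKernel {α b : ℝ} (hα0 : 0 < α) (hb : 0 < b) :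
    DifferentiableOn ℂ (fermiKernel α b) {z | |z.im| < Real.pi / α} := by
  intro z hz
  have hz' : |z.im| < Real.pi / α := hz
  have hne := exp_add_ofReal_ne_zero (w := α * z) (b := b)
    (by simpa [abs_mul, abs_of_pos hα0, lt_div_iff₀' hα0] using hz') hb
  have hd : DifferentiableAt ℂ (fun ζ : ℂ => Complex.exp (α * ζ) + b) z := by fun_prop
  exact (hd.inv hne).differentiableWithinAt

/-- Numerator and denominator both vanish at `μ`, so the quotient of their divided differences has
no pole there. The open strip `|Im ζ| < π/α`, where `1/(e^{αζ} + b)` is holomorphic, contains the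
closed strip `|Im ζ| ≤ π` because `α < 1`. -/
theorem differentiableOn_regularizedKernel {α b : ℝ} (hα0 : 0 < α) (hα1 : α < 1) (hb : 0 < b)
    {μ : ℂ} (hμ : |μ.im| < Real.pi) :
    DifferentiableOn ℂ (regularizedKernel α b μ) {z | z.im ∈ Set.Icc (-Real.pi) Real.pi} := by
  have hpi := Real.pi_pos
  have hpa : Real.pi < Real.pi / α := by rw [lt_div_iff₀ hα0]; nlinarith
  have hopen : {z : ℂ | |z.im| < Real.pi / α} ∈ 𝓝 μ :=
    (isOpen_lt (by fun_prop) continuous_const).mem_nhds (lt_trans hμ hpa)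
  have hsub : {z : ℂ | z.im ∈ Set.Icc (-Real.pi) Real.pi} ⊆ {z : ℂ | |z.im| < Real.pi / α} :=
    fun z hz => (abs_le.2 hz).trans_lt hpa
  have h1 : DifferentiableOn ℂ (dslope (fun ζ => Complex.exp ((ζ - μ) / 2) * fermiKernel α b ζ -
      fermiKernel α b μ) μ) {z : ℂ | |z.im| < Real.pi / α} := by
    rw [Complex.differentiableOn_dslope hopen]
    refine DifferentiableOn.sub_const (DifferentiableOn.mul
      (Differentiable.differentiableOn (by fun_prop)) (differentiableOn_fermiKernel hα0 hb)) _
  have h2 : DifferentiableOn ℂ (dslope (fun ζ => Complex.exp ((ζ - μ) / 2) -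
      Complex.exp (-((ζ - μ) / 2))) μ) {z : ℂ | |z.im| < Real.pi / α} := by
    rw [Complex.differentiableOn_dslope hopen]
    exact Differentiable.differentiableOn (by fun_prop)
  refine (h1.mono hsub).div (h2.mono hsub) fun z hz => ?_
  -- The denominator has derivative 1 at `μ`; elsewhere `|Im(z - μ)| < 2π` excludes the other zeros
  -- of the hyperbolic sine.
  rcases eq_or_ne z μ with rfl | hne
  · rw [dslope_same]
    have hd : HasDerivAt (fun ζ => Complex.exp ((ζ - z) / 2) - Complex.exp (-((ζ - z) / 2)))
        (Complex.exp ((z - z) / 2) * (1 / 2) - Complex.exp (-((z - z) / 2)) * (-(1 / 2))) z := by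
      have h := (((hasDerivAt_id z).sub_const z).div_const 2)
      exact h.cexp.sub h.neg.cexp
    rw [hd.deriv]
    norm_num
  · rw [dslope_of_ne _ hne, slope_def_field]
    have := exp_half_sub_ne_zero (u := z - μ) (by
      have := abs_le.2 hz
      calc |(z - μ).im| = |z.im - μ.im| := by simp
        _ ≤ |z.im| + |μ.im| := abs_sub _ _
        _ < _ := by linarith) (sub_ne_zero.2 hne)
    simpa using ⟨this, sub_ne_zero.2 hne⟩

/-- To the right, `e^{u/2}` times the sinh kernel is bounded (`u = ζ - μ`) and `1/(e^{αζ} + b)`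
decays at rate `α`. To the left, the latter is bounded and the sinh kernel decays at rate `1/2`. The
subtracted term decays at rate `1/2` on both sides, whence the rate `min α (1/2)`. -/
theorem exists_bound_regularizedKernel {α b : ℝ} (hα0 : 0 < α) (hb : 0 < b) (μ : ℂ) :
    ∃ C T : ℝ, ∀ ζ : ℂ, T ≤ |ζ.re| →
      ‖regularizedKernel α b μ ζ‖ ≤ C * (1 + ζ.re ^ 2)⁻¹ := by
  set M := |μ.re| with hM
  set c := min α (1 / 2) with hc
  have hc0 : 0 < c := lt_min hα0 (by norm_num)
  set H := ‖fermiKernel α b μ‖ with hH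
  -- In the threshold, `M + 1` ensures `|Re(ζ - μ)| ≥ 1`, and the two logarithms ensure that one of
  -- `e^{αζ}` and `b` is at least twice the other in modulus.
  refine ⟨(4 + 4 / b * Real.exp (M / 2) + H * (2 * Real.exp (M / 2))) * max 1 (2 / c ^ 2),
    M + 1 + |Real.log (2 * b)| / α + |Real.log (2 / b)| / α, fun ζ hζ => ?_⟩
  have hM0 : 0 ≤ M := abs_nonneg _
  have hl1 : 0 ≤ |Real.log (2 * b)| / α := by positivity
  have hl2 : 0 ≤ |Real.log (2 / b)| / α := by positivity
  have hne : ζ ≠ μ := by rintro rfl; linarith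
  have hure : (ζ - μ).re = ζ.re - μ.re := by simp
  have hu : |ζ.re| - M ≤ |(ζ - μ).re| := by
    rw [hure]; exact abs_sub_abs_le_abs_sub _ _
  have hu1 : 1 ≤ |(ζ - μ).re| := by linarith
  have hK := norm_sinhKernel_le hu1
  have hce : Real.exp (-(1 / 2) * |ζ.re|) ≤ Real.exp (-c * |ζ.re|) := by
    have := min_le_right α (1 / 2)
    gcongr
  have hE : Real.exp (-(|(ζ - μ).re| / 2)) ≤ Real.exp (M / 2) * Real.exp (-c * |ζ.re|) := by
    calc _ ≤ Real.exp (M / 2 + -(1 / 2) * |ζ.re|) := Real.exp_le_exp.2 (by linarith)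
      _ = Real.exp (M / 2) * Real.exp (-(1 / 2) * |ζ.re|) := Real.exp_add _ _
      _ ≤ _ := by gcongr
  have hmain : ‖Complex.exp ((ζ - μ) / 2) * sinhKernel (ζ - μ) * fermiKernel α b ζ‖ ≤
      (4 + 4 / b * Real.exp (M / 2)) * Real.exp (-c * |ζ.re|) := by
    rw [norm_mul, norm_mul]
    have e1 : ‖Complex.exp ((ζ - μ) / 2)‖ = Real.exp ((ζ - μ).re / 2) := by
      simp [Complex.norm_exp]
    rw [e1]
    rcases le_total 0 ζ.re with h0 | h0
    · rw [abs_of_nonneg h0] at hζ hce hE hu ⊢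
      have hupos : 0 ≤ (ζ - μ).re := by
        have := le_abs_self μ.re; rw [hure]; linarith
      rw [abs_of_nonneg hupos] at hK
      have hf := norm_fermiKernel_le_pos (α := α) (ζ := ζ) hb (by
        rw [← Real.log_le_iff_le_exp (by positivity)]
        have : |Real.log (2 * b)| / α ≤ ζ.re := by linarith
        rw [div_le_iff₀' hα0] at this
        exact (le_abs_self _).trans this)
      have h2 : Real.exp (-(α * ζ.re)) ≤ Real.exp (-c * ζ.re) := by
        have := min_le_left α (1 / 2)
        rw [← neg_mul]
        gcongr
      calc _ ≤ Real.exp ((ζ - μ).re / 2) * (2 * Real.exp (-((ζ - μ).re / 2))) *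
            (2 * Real.exp (-(α * ζ.re))) := by gcongr
        _ = 4 * Real.exp (-(α * ζ.re)) := by
            rw [Real.exp_neg ((ζ - μ).re / 2)]; field_simp; norm_num
        _ ≤ 4 * Real.exp (-c * ζ.re) := by gcongr
        _ ≤ _ := by
            gcongr
            have : 0 ≤ 4 / b * Real.exp (M / 2) := by positivity
            linarith
    · rw [abs_of_nonpos h0] at hζ hce hE hu ⊢
      have huneg : (ζ - μ).re ≤ 0 := by
        have := neg_abs_le μ.re; rw [hure]; linarith
      have hf := norm_fermiKernel_le_neg (α := α) (ζ := ζ) hb (by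
        have h3 : |Real.log (2 / b)| / α ≤ -ζ.re := by linarith
        rw [div_le_iff₀' hα0] at h3
        have h4 : α * ζ.re ≤ Real.log (b / 2) := by
          rw [← inv_div 2 b, Real.log_inv]
          linarith [le_abs_self (Real.log (2 / b))]
        calc _ ≤ Real.exp (Real.log (b / 2)) := Real.exp_le_exp.2 h4
          _ = b / 2 := Real.exp_log (by positivity))
      have h5 : Real.exp ((ζ - μ).re / 2) ≤ 1 := Real.exp_le_one_iff.2 (by linarith)
      calc _ ≤ 1 * (2 * Real.exp (-(|(ζ - μ).re| / 2))) * (2 / b) := by gcongr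
        _ = 4 / b * Real.exp (-(|(ζ - μ).re| / 2)) := by ring
        _ ≤ 4 / b * (Real.exp (M / 2) * Real.exp (-c * -ζ.re)) := by gcongr
        _ ≤ _ := by
            rw [← mul_assoc]
            gcongr
            linarith
  rw [regularizedKernel_of_ne hne]
  refine (norm_sub_le _ _).trans ?_
  rw [norm_mul (fermiKernel α b μ)]
  calc _ ≤ (4 + 4 / b * Real.exp (M / 2)) * Real.exp (-c * |ζ.re|) +
        H * (2 * (Real.exp (M / 2) * Real.exp (-c * |ζ.re|))) := by
        gcongr
        exact hK.trans (by gcongr)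
    _ = (4 + 4 / b * Real.exp (M / 2) + H * (2 * Real.exp (M / 2))) * Real.exp (-c * |ζ.re|) := by
        ring
    _ ≤ _ := by
        rw [mul_assoc _ (max 1 (2 / c ^ 2))]
        gcongr
        exact exp_neg_mul_abs_le hc0 _

/-- Origin of the quadrature weight: with `E = e^{αx}` the denominators on the two lines are the
conjugates `E e^{∓iπα} + b`, whose product is `E (E + 2b cos πα + b²/E)` and whose difference is `2i
E sin πα` in modulus. -/
theorem fermiKernel_neg_pi_sub {α b : ℝ} (hα0 : 0 < α) (hα1 : α < 1) (hb : 0 < b) (x : ℝ) :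
    fermiKernel α b (x + (-Real.pi : ℝ) * Complex.I) - fermiKernel α b (x + Real.pi * Complex.I) =
      2 * Complex.I * Real.sin (Real.pi * α) *
        (((Real.exp (α * x) + 2 * b * Real.cos (Real.pi * α) +
          b ^ 2 * Real.exp (-(α * x)))⁻¹ : ℝ) : ℂ) := by
  have hpi := Real.pi_pos
  have key : ∀ y : ℝ, |y| = Real.pi → Complex.exp (α * (x + y * Complex.I)) + b ≠ 0 := by
    intro y hy
    refine exp_add_ofReal_ne_zero ?_ hb
    have : ((α : ℂ) * (x + y * Complex.I)).im = α * y := by simp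
    rw [this, abs_mul, hy, abs_of_pos hα0]
    nlinarith
  have h1 := key (-Real.pi) (by rw [abs_neg, abs_of_pos hpi])
  have h2 := key Real.pi (abs_of_pos hpi)
  rw [fermiKernel, fermiKernel, inv_sub_inv h1 h2]
  set E := Real.exp (α * x) with hE
  have hE0 : (E : ℂ) ≠ 0 := by exact_mod_cast (Real.exp_pos _).ne'
  have hexp : ∀ y : ℝ, Complex.exp (α * (x + y * Complex.I)) =
      E * (Real.cos (α * y) + Real.sin (α * y) * Complex.I) := by
    intro y
    have e : (α : ℂ) * (x + y * Complex.I) = ((α * x : ℝ) : ℂ) + ((α * y : ℝ) : ℂ) * Complex.I := by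
      push_cast; ring
    rw [e, Complex.exp_add, Complex.exp_mul_I, ← Complex.ofReal_exp, ← Complex.ofReal_cos,
      ← Complex.ofReal_sin]
  rw [hexp, hexp, mul_neg, Real.cos_neg, Real.sin_neg, mul_comm α Real.pi] at *
  set c := Real.cos (Real.pi * α)
  set s := Real.sin (Real.pi * α)
  have hcs : (s : ℂ) ^ 2 + (c : ℂ) ^ 2 = 1 := by exact_mod_cast Real.sin_sq_add_cos_sq _
  have hprod : ((E : ℂ) * (c + (-s : ℝ) * Complex.I) + b) * (E * (c + s * Complex.I) + b) =
      E * ((E + 2 * b * c + b ^ 2 * E⁻¹ : ℝ) : ℂ) := by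
    have hI := Complex.I_sq
    push_cast
    field_simp
    linear_combination (E : ℂ) ^ 2 * hcs - (E : ℂ) ^ 2 * s ^ 2 * hI
  rw [Real.exp_neg, hprod]
  have hne : ((E + 2 * b * c + b ^ 2 * E⁻¹ : ℝ) : ℂ) ≠ 0 := by
    have := mul_ne_zero h1 h2
    rw [hprod] at this
    exact right_ne_zero_of_mul this
  rw [Complex.ofReal_inv, div_eq_iff (mul_ne_zero hE0 hne)]
  have hx := inv_mul_cancel₀ hne
  generalize ((E + 2 * b * c + b ^ 2 * E⁻¹ : ℝ) : ℂ) = X at hx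
  rw [Complex.ofReal_neg]
  linear_combination -(2 * Complex.I * s * E) * hx

/-- The product is `2πi`-periodic, although the sinh kernel alone only changes sign under that
shift. Hence the main term sees the same resolvent factor on both lines, while the subtracted term
contributes twice. -/
theorem exp_half_mul_sinhKernel (u : ℂ) :
    Complex.exp (u / 2) * sinhKernel u = (1 - Complex.exp (-u))⁻¹ := by
  have h : 1 - Complex.exp (-u) =
      Complex.exp (-(u / 2)) * (Complex.exp (u / 2) - Complex.exp (-(u / 2))) := by
    rw [mul_sub, ← Complex.exp_add, ← Complex.exp_add]
    have e1 : -(u / 2) + u / 2 = 0 := by ring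
    have e2 : -(u / 2) + -(u / 2) = -u := by ring
    rw [e1, e2, Complex.exp_zero]
  rw [h, mul_inv, ← Complex.exp_neg, neg_neg, sinhKernel]

theorem sinhKernel_add_two_pi (u : ℂ) :
    sinhKernel (u + 2 * Real.pi * Complex.I) = -sinhKernel u := by
  have e1 : (u + 2 * Real.pi * Complex.I) / 2 = u / 2 + Real.pi * Complex.I := by ring
  have e2 : -(u / 2 + Real.pi * Complex.I) = -(u / 2) - Real.pi * Complex.I := by ring
  rw [sinhKernel, e1, e2, Complex.exp_add, Complex.exp_sub, Complex.exp_pi_mul_I, sinhKernel,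
    ← inv_neg]
  congr 1
  ring

/-- The regularized kernel has equal integrals over `Im ζ = ±π`. Their difference is `2i sin(πα)`
times the wanted integral minus `2/(e^{αμ} + b)` times the integral of the sinh kernel, which equals
`πi`; setting this to zero gives the formula. -/
theorem integral_log_variable {α b : ℝ} (hα0 : 0 < α) (hα1 : α < 1) (hb : 0 < b) {μ : ℂ}
    (hμ : |μ.im| < Real.pi) :
    ∫ x : ℝ, (((Real.exp (α * x) + 2 * b * Real.cos (Real.pi * α) +
          b ^ 2 * Real.exp (-(α * x)))⁻¹ : ℝ) : ℂ) * (1 + Complex.exp (-x) * Complex.exp μ)⁻¹ =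
      (Real.pi / Real.sin (Real.pi * α) : ℝ) * fermiKernel α b μ := by
  have hpi := Real.pi_pos
  obtain ⟨C, T, hCT⟩ := exists_bound_regularizedKernel hα0 hb μ
  have hμ' := abs_lt.1 hμ
  have hd := differentiableOn_regularizedKernel hα0 hα1 hb hμ
  have hshift := integral_line_eq_integral_line (by linarith) hd (fun z _ hz => hCT z hz)
  have hint : ∀ y ∈ Set.Icc (-Real.pi) Real.pi,
      Integrable fun x : ℝ => regularizedKernel α b μ (x + y * Complex.I) :=
    fun y hy => integrable_line hy hd (fun z _ hz => hCT z hz)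
  have hKarg : ∀ x : ℝ, (x : ℂ) + (-Real.pi : ℝ) * Complex.I - μ =
      ((x - μ.re : ℝ) : ℂ) + (-Real.pi - μ.im : ℝ) * Complex.I := by
    intro x
    apply Complex.ext <;> simp
  have hKint : Integrable fun x : ℝ => sinhKernel ((x : ℂ) + (-Real.pi : ℝ) * Complex.I - μ) := by
    simp only [hKarg]
    have := integrable_line (y := -Real.pi - μ.im) (p := -Real.pi - μ.im) (q := -Real.pi - μ.im)
      (by simp) (differentiableOn_sinhKernel (by linarith) (by linarith))
      (fun z _ hz => norm_sinhKernel_le_inv z hz)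
    exact this.comp_sub_right μ.re
  have hKval : ∫ x : ℝ, sinhKernel ((x : ℂ) + (-Real.pi : ℝ) * Complex.I - μ) =
      Real.pi * Complex.I := by
    simp only [hKarg]
    exact integral_sinhKernel_line (by linarith) (by linarith) _
  have hKper : ∀ x : ℝ, sinhKernel ((x : ℂ) + Real.pi * Complex.I - μ) =
      -sinhKernel ((x : ℂ) + (-Real.pi : ℝ) * Complex.I - μ) := by
    intro x
    rw [← sinhKernel_add_two_pi]
    congr 1
    push_cast
    ring
  have hexp : ∀ x : ℝ, ∀ y : ℝ, y = -Real.pi ∨ y = Real.pi →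
      Complex.exp (((x : ℂ) + y * Complex.I - μ) / 2) * sinhKernel ((x : ℂ) + y * Complex.I - μ) =
        (1 + Complex.exp (-x) * Complex.exp μ)⁻¹ := by
    intro x y hy
    rw [exp_half_mul_sinhKernel]
    congr 1
    have e : -((x : ℂ) + y * Complex.I - μ) = -x + μ + (-y : ℝ) * Complex.I := by push_cast; ring
    rw [e, Complex.exp_add, Complex.exp_add]
    have : Complex.exp ((-y : ℝ) * Complex.I) = -1 := by
      rcases hy with rfl | rfl
      · rw [neg_neg, Complex.exp_pi_mul_I]
      · rw [Complex.ofReal_neg, neg_mul, Complex.exp_neg, Complex.exp_pi_mul_I, inv_neg, inv_one]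
    rw [this]
    ring
  have hne : ∀ x y : ℝ, y = -Real.pi ∨ y = Real.pi → (x : ℂ) + y * Complex.I ≠ μ := by
    rintro x y hy rfl
    simp at hμ'
    rcases hy with rfl | rfl <;> linarith
  have hdiff : ∀ x : ℝ, regularizedKernel α b μ (x + (-Real.pi : ℝ) * Complex.I) -
      regularizedKernel α b μ (x + Real.pi * Complex.I) =
      2 * Complex.I * Real.sin (Real.pi * α) *
        ((((Real.exp (α * x) + 2 * b * Real.cos (Real.pi * α) +
          b ^ 2 * Real.exp (-(α * x)))⁻¹ : ℝ) : ℂ) * (1 + Complex.exp (-x) * Complex.exp μ)⁻¹) -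
      2 * fermiKernel α b μ * sinhKernel ((x : ℂ) + (-Real.pi : ℝ) * Complex.I - μ) := by
    intro x
    rw [regularizedKernel_of_ne (hne x _ (Or.inl rfl)),
      regularizedKernel_of_ne (hne x _ (Or.inr rfl)),
      hexp x _ (Or.inl rfl), hexp x _ (Or.inr rfl), hKper]
    linear_combination (1 + Complex.exp (-x) * Complex.exp μ)⁻¹ *
      fermiKernel_neg_pi_sub hα0 hα1 hb x
  have h1 := (hint _ ⟨le_rfl, by linarith⟩).sub (hint Real.pi ⟨by linarith, le_rfl⟩)
  have h0 := integral_sub (hint _ ⟨le_rfl, by linarith⟩) (hint Real.pi ⟨by linarith, le_rfl⟩)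
  rw [hshift, sub_self] at h0
  have hsin : 0 < Real.sin (Real.pi * α) :=
    Real.sin_pos_of_pos_of_lt_pi (by positivity) (by nlinarith)
  have h2 := h1.add (hKint.const_mul (2 * fermiKernel α b μ))
  have h3 := integral_add h1 (hKint.const_mul (2 * fermiKernel α b μ))
  simp only [Pi.sub_apply] at h3
  rw [h0, integral_const_mul, hKval, zero_add] at h3
  simp only [hdiff, sub_add_cancel] at h3
  rw [integral_const_mul] at h3
  have hs : (Real.sin (Real.pi * α) : ℂ) ≠ 0 := by exact_mod_cast hsin.ne'
  have hc : 2 * Complex.I * (Real.sin (Real.pi * α) : ℂ) ≠ 0 :=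
    mul_ne_zero (mul_ne_zero two_ne_zero Complex.I_ne_zero) hs
  refine mul_left_cancel₀ hc (h3.trans ?_)
  rw [Complex.ofReal_div]
  field_simp

/-- The integral representation of `1 / (λ^α + b)`. -/
theorem integral_quadrature_scalar {α b : ℝ} (hα0 : 0 < α) (hα1 : α < 1) (hb : 0 < b) {l : ℂ}
    (hl : l ∈ Complex.slitPlane) :
    ∫ s : ℝ, (((Real.exp s + 2 * b * Real.cos (Real.pi * α) +
          b ^ 2 * Real.exp (-s))⁻¹ : ℝ) : ℂ) * (1 + (Real.exp (-s / α) : ℝ) * l)⁻¹ =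
      (α * Real.pi / Real.sin (Real.pi * α) : ℝ) * (l ^ (α : ℂ) + b)⁻¹ := by
  have hl0 : l ≠ 0 := Complex.slitPlane_ne_zero hl
  have hlog : |(Complex.log l).im| < Real.pi := by
    rw [Complex.log_im, abs_lt]
    exact ⟨Complex.neg_pi_lt_arg _, lt_of_le_of_ne (Complex.arg_le_pi _)
      (Complex.mem_slitPlane_iff_arg.1 hl).1⟩
  have h := integral_log_variable hα0 hα1 hb hlog
  -- The substitution `s = αx` with `μ = log l`; it is responsible for the extra factor `α` on the
  -- right.
  have hcv := Measure.integral_comp_mul_left (fun s : ℝ =>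
    (((Real.exp s + 2 * b * Real.cos (Real.pi * α) +
          b ^ 2 * Real.exp (-s))⁻¹ : ℝ) : ℂ) * (1 + (Real.exp (-s / α) : ℝ) * l)⁻¹) α
  have e : ∀ x : ℝ, ((Real.exp (-(α * x) / α) : ℝ) : ℂ) * l =
      Complex.exp (-x) * Complex.exp (Complex.log l) := by
    intro x
    rw [Complex.exp_log hl0, Complex.ofReal_exp]
    congr 3
    rw [← Complex.ofReal_neg]
    congr 1
    field_simp
  simp only [e] at hcv
  rw [h, abs_of_pos (inv_pos.2 hα0), fermiKernel, mul_comm (α : ℂ), ← Complex.cpow_def_of_ne_zero hl0,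
    Complex.real_smul] at hcv
  have hα : (α : ℂ) ≠ 0 := by exact_mod_cast hα0.ne'
  rw [Complex.ofReal_inv, eq_inv_mul_iff_mul_eq₀ hα] at hcv
  rw [← hcv]
  push_cast
  ring

/-! ## The scalar factor of the integrand in a strip -/

/-- The function `1 / ((1 + |x|) (|x| + δ))`. -/
noncomputable def poleKernel (δ x : ℝ) : ℝ := ((1 + |x|) * (|x| + δ))⁻¹

theorem poleKernel_nonneg {δ : ℝ} (hδ : 0 < δ) (x : ℝ) : 0 ≤ poleKernel δ x := by
  rw [poleKernel]; positivity

theorem poleKernel_le {δ : ℝ} (hδ : 0 < δ) (hδ1 : δ ≤ 1) (x : ℝ) :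
    poleKernel δ x ≤ δ⁻¹ * (1 + x ^ 2)⁻¹ := by
  rw [poleKernel, ← mul_inv]
  have := abs_nonneg x
  refine inv_anti₀ (by positivity) ?_
  rw [← sq_abs x]
  nlinarith

theorem poleKernel_sub_le {δ : ℝ} (hδ : 0 < δ) (hδ1 : δ ≤ 1) (c x : ℝ) :
    poleKernel δ (x - c) ≤ δ⁻¹ * (2 * (1 + c ^ 2)) * (1 + x ^ 2)⁻¹ := by
  refine (poleKernel_le hδ hδ1 _).trans ?_
  rw [mul_assoc]
  gcongr
  rw [inv_le_iff_one_le_mul₀ (by positivity), mul_comm, ← mul_assoc, ← div_eq_mul_inv,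
    one_le_div (by positivity)]
  nlinarith [sq_nonneg (x - 2 * c), mul_nonneg (sq_nonneg c) (sq_nonneg (x - c))]

theorem integrable_poleKernel {δ : ℝ} (hδ : 0 < δ) (hδ1 : δ ≤ 1) : Integrable (poleKernel δ) := by
  refine (integrable_inv_one_add_sq.const_mul δ⁻¹).mono' ?_ (Eventually.of_forall fun x => ?_)
  · refine Continuous.aestronglyMeasurable ?_
    unfold poleKernel
    refine Continuous.inv₀ (by fun_prop) fun x => by positivity
  · rw [Real.norm_of_nonneg (poleKernel_nonneg hδ x)]
    exact poleKernel_le hδ hδ1 x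

/-- Half of the integral is evaluated with the primitive `log((x + δ)/(x + 1))/(1 - δ)`, and `δ ≤
1/2` bounds `1/(1 - δ)` by 2. This is the source of the logarithm in `C(τ)`. -/
theorem integral_poleKernel_le {δ : ℝ} (hδ : 0 < δ) (hδ1 : δ ≤ 1 / 2) :
    ∫ x, poleKernel δ x ≤ 4 * |Real.log δ| := by
  have hδ2 : 0 < 1 - δ := by linarith
  have h1 : ∫ x, poleKernel δ x = 2 * ∫ x in Set.Ioi (0:ℝ), ((1 + x) * (x + δ))⁻¹ :=
    integral_comp_abs (f := fun x => ((1 + x) * (x + δ))⁻¹)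
  have h2 : ∫ x in Set.Ioi (0:ℝ), ((1 + x) * (x + δ))⁻¹ = 0 - (1 - δ)⁻¹ * Real.log ((0 + δ) / (0 + 1)) := by
    refine integral_Ioi_of_hasDerivAt_of_nonneg'
      (g := fun x => (1 - δ)⁻¹ * Real.log ((x + δ) / (x + 1))) ?_ ?_ ?_
    · intro x hx
      have hx0 : 0 ≤ x := hx
      have hd : HasDerivAt (fun x => (x + δ) / (x + 1)) ((1 * (x + 1) - (x + δ) * 1) / (x + 1) ^ 2) x :=
        ((hasDerivAt_id x).add_const δ).div ((hasDerivAt_id x).add_const 1) (by positivity)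
      have := (hd.log (by positivity)).const_mul (1 - δ)⁻¹
      have e : ((1 + x) * (x + δ))⁻¹ =
          (1 - δ)⁻¹ * ((1 * (x + 1) - (x + δ) * 1) / (x + 1) ^ 2 / ((x + δ) / (x + 1))) := by
        have : x + δ ≠ 0 := by positivity
        have : x + 1 ≠ 0 := by positivity
        have : 1 + x ≠ 0 := by positivity
        have := hδ2.ne'
        field_simp
        ring
      rw [e]
      exact this
    · intro x hx
      have hx0 : 0 < x := hx
      positivity
    · have h3 : Tendsto (fun x : ℝ => 1 - (1 - δ) * (x + 1)⁻¹) atTop (𝓝 (1 - (1 - δ) * 0)) :=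
        ((tendsto_inv_atTop_zero.comp (tendsto_atTop_add_const_right _ 1 tendsto_id)).const_mul
          (1 - δ)).const_sub 1
      rw [mul_zero, sub_zero] at h3
      have h4 : Tendsto (fun x : ℝ => (x + δ) / (x + 1)) atTop (𝓝 1) := by
        refine h3.congr' ?_
        filter_upwards [eventually_ge_atTop 0] with x hx
        have : x + 1 ≠ 0 := by positivity
        field_simp
        ring
      have h5 := ((Real.continuousAt_log one_ne_zero).tendsto.comp h4).const_mul (1 - δ)⁻¹
      simpa using h5
  rw [h1, h2, zero_add, zero_add, div_one, abs_of_neg (Real.log_neg hδ (by linarith))]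
  have h6 : (1 - δ)⁻¹ ≤ 2 := by
    rw [inv_le_comm₀ hδ2 two_pos]; linarith
  have h7 : 0 ≤ -Real.log δ := by
    have := Real.log_neg hδ (by linarith); linarith
  nlinarith

/-! ### Lower bounds for the complex denominator. -/

theorem sq_norm_sinh (x y : ℝ) :
    ‖Complex.sinh (x + y * Complex.I)‖ ^ 2 = Real.sinh x ^ 2 + Real.sin y ^ 2 := by
  have e : Complex.sinh (x + y * Complex.I) = ((Real.sinh x * Real.cos y : ℝ) : ℂ) +
      ((Real.cosh x * Real.sin y : ℝ) : ℂ) * Complex.I := by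
    rw [Complex.sinh_add, Complex.sinh_mul_I, Complex.cosh_mul_I]
    push_cast
    ring
  rw [e, Complex.sq_norm, Complex.normSq_add_mul_I]
  linear_combination Real.sinh x ^ 2 * Real.sin_sq_add_cos_sq y + Real.sin y ^ 2 * Real.cosh_sq x

/-- The modulus dominates both `|sinh x| ≥ |x|` and `|sin y|`, hence also their mean. -/
theorem half_add_le_norm_sinh {x y s : ℝ} (h : s ≤ |Real.sin y|) :
    (|x| + s) / 2 ≤ ‖Complex.sinh (x + y * Complex.I)‖ := by
  have h1 : |x| ≤ |Real.sinh x| := by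
    rw [Real.abs_sinh]; exact Real.self_le_sinh_iff.2 (abs_nonneg x)
  have h2 := sq_norm_sinh x y
  have h3 : |Real.sinh x| ≤ ‖Complex.sinh (x + y * Complex.I)‖ := by
    refine abs_le_of_sq_le_sq ?_ (norm_nonneg _)
    rw [h2]; nlinarith [sq_nonneg (Real.sin y)]
  have h4 : |Real.sin y| ≤ ‖Complex.sinh (x + y * Complex.I)‖ := by
    refine abs_le_of_sq_le_sq ?_ (norm_nonneg _)
    rw [h2]; nlinarith [sq_nonneg (Real.sinh x)]
  linarith

/-- The denominator `e^z + 2 b cos(πα) + b² e^{-z}` on complex arguments. -/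
noncomputable def quadDenom (α b : ℝ) (z : ℂ) : ℂ :=
  Complex.exp z + 2 * b * Real.cos (Real.pi * α) + b ^ 2 * Complex.exp (-z)

/-- With `w = z - log b` the denominator is `2b (cosh w + cos πα) = 2b (cosh w - cosh(iκ₂))`, and a
difference of hyperbolic cosines factors. The zeros `log b ± iκ₂` become visible. -/
theorem quadDenom_eq_sinh_mul_sinh {α b : ℝ} (hb : 0 < b) (z : ℂ) :
    quadDenom α b z = 4 * b *
      Complex.sinh ((z - Real.log b + kappa2 α * Complex.I) / 2) *
      Complex.sinh ((z - Real.log b - kappa2 α * Complex.I) / 2) := by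
  have hb' : (b : ℂ) ≠ 0 := by exact_mod_cast hb.ne'
  have hlog : Complex.exp (Real.log b) = b := by
    rw [← Complex.ofReal_exp, Real.exp_log hb]
  set w := z - Real.log b with hw
  have hz : z = w + Real.log b := by rw [hw]; ring
  have hprod : ∀ u v : ℂ, 2 * (Complex.sinh u * Complex.sinh v) =
      Complex.cosh (u + v) - Complex.cosh (u - v) := by
    intro u v; rw [Complex.cosh_add, Complex.cosh_sub]; ring
  have hcos : Complex.cosh (kappa2 α * Complex.I) = -Real.cos (Real.pi * α) := by
    rw [Complex.cosh_mul_I, ← Complex.ofReal_cos, kappa2]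
    have : (1 - α) * Real.pi = Real.pi - Real.pi * α := by ring
    rw [this, Real.cos_pi_sub]; simp
  have e1 : (w + kappa2 α * Complex.I) / 2 + (w - kappa2 α * Complex.I) / 2 = w := by ring
  have e2 : (w + kappa2 α * Complex.I) / 2 - (w - kappa2 α * Complex.I) / 2 =
    kappa2 α * Complex.I := by ring
  have h := hprod ((w + kappa2 α * Complex.I) / 2) ((w - kappa2 α * Complex.I) / 2)
  rw [e1, e2, hcos, Complex.cosh] at h
  have h3 : Complex.exp (-z) = Complex.exp (-w) * (b : ℂ)⁻¹ := by
    rw [hz, neg_add, Complex.exp_add, Complex.exp_neg (Real.log b : ℂ), hlog]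
  have h4 : Complex.exp z = Complex.exp w * b := by rw [hz, Complex.exp_add, hlog]
  rw [quadDenom, h3, h4, mul_assoc (4 * (b : ℂ))]
  have h5 : (b : ℂ) ^ 2 * (Complex.exp (-w) * (b : ℂ)⁻¹) = b * Complex.exp (-w) := by
    field_simp
  rw [h5]
  linear_combination (-2 * (b : ℂ)) * h

theorem two_div_pi_mul_le_sin {x : ℝ} (h0 : 0 ≤ x) (h1 : x ≤ Real.pi / 2) :
    2 / Real.pi * x ≤ Real.sin x := Real.mul_le_sin h0 h1

/-- According to the sign of `Im z`, one hyperbolic sine stays away from its zeros and contributes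
`1 + |x|`; the other may come close to a zero and contributes `|x| + δ`. Jordan's inequality bounds
the sines from below. -/
theorem le_norm_quadDenom {α b d : ℝ} (hα0 : 0 < α) (hα1 : α < 1) (hb : 0 < b)
    (hdk : d < kappa2 α) {z : ℂ} (hz : |z.im| ≤ d) :
    b * min α (1 - α) / 2 *
      ((1 + |z.re - Real.log b|) * (|z.re - Real.log b| + (kappa2 α - d) / (2 * Real.pi))) ≤
      ‖quadDenom α b z‖ := by
  have hpi := Real.pi_pos
  set κ := kappa2 α with hκ
  have hκpi : κ = (1 - α) * Real.pi := rfl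
  set x := z.re - Real.log b with hx
  set m := min α (1 - α) with hm
  have hm0 : 0 < m := lt_min hα0 (by linarith)
  have hm1 : m ≤ α := min_le_left _ _
  have hm2 : m ≤ 1 - α := min_le_right _ _
  set δ := (κ - d) / (2 * Real.pi) with hδ
  have hδ0 : 0 < δ := div_pos (by linarith) (by positivity)
  have hzeq : ∀ q : ℝ, (z - Real.log b + q * Complex.I) / 2 =
      ((x / 2 : ℝ) : ℂ) + (((z.im + q) / 2 : ℝ) : ℂ) * Complex.I := by
    intro q
    apply Complex.ext <;> simp [hx]
  -- Jordan's inequality is applied at `|q|` or at `π - |q|`; this is where both `1 - α` and `α`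
  -- enter the constant `m`.
  have hfar : ∀ q : ℝ, κ / 2 ≤ |q| → |q| ≤ κ → m / 2 * (1 + |x|) ≤
      ‖Complex.sinh (((x / 2 : ℝ) : ℂ) + (q : ℂ) * Complex.I)‖ := by
    intro q h1 h2
    have hs : m ≤ |Real.sin q| := by
      rw [Real.abs_sin_eq_sin_abs_of_abs_le_pi (by nlinarith)]
      rcases le_total |q| (Real.pi / 2) with h | h
      · refine le_trans ?_ (two_div_pi_mul_le_sin (abs_nonneg q) h)
        rw [div_mul_eq_mul_div, le_div_iff₀ hpi]
        nlinarith
      · rw [← Real.sin_pi_sub]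
        refine le_trans ?_ (two_div_pi_mul_le_sin (by nlinarith) (by linarith))
        rw [div_mul_eq_mul_div, le_div_iff₀ hpi]
        nlinarith
    refine le_trans ?_ (half_add_le_norm_sinh hs)
    rw [abs_div, abs_two]
    nlinarith [abs_nonneg x]
  have hnear : ∀ q : ℝ, (κ - d) / 2 ≤ |q| → |q| ≤ κ / 2 → (|x| + δ) / 4 ≤
      ‖Complex.sinh (((x / 2 : ℝ) : ℂ) + (q : ℂ) * Complex.I)‖ := by
    intro q h1 h2
    have hs : 2 * δ ≤ |Real.sin q| := by
      rw [Real.abs_sin_eq_sin_abs_of_abs_le_pi (by nlinarith)]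
      refine le_trans ?_ (two_div_pi_mul_le_sin (abs_nonneg q) (by nlinarith))
      rw [hδ, div_mul_eq_mul_div, le_div_iff₀ hpi]
      have : 2 * ((κ - d) / (2 * Real.pi)) * Real.pi = κ - d := by field_simp
      linarith
    refine le_trans ?_ (half_add_le_norm_sinh hs)
    rw [abs_div, abs_two]
    nlinarith [abs_nonneg x]
  have hzim := abs_le.1 hz
  rw [quadDenom_eq_sinh_mul_sinh hb, sub_eq_add_neg _ ((kappa2 α : ℂ) * Complex.I), ← neg_mul,
    ← Complex.ofReal_neg, hzeq, hzeq, norm_mul, norm_mul, norm_mul, Complex.norm_real,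
    Real.norm_of_nonneg hb.le]
  have h4 : ‖(4 : ℂ)‖ = 4 := by simp
  rw [h4, mul_assoc (4 * b)]
  have hprod : m / 2 * (1 + |x|) * ((|x| + δ) / 4) ≤
      ‖Complex.sinh (((x / 2 : ℝ) : ℂ) + (((z.im + kappa2 α) / 2 : ℝ) : ℂ) * Complex.I)‖ *
      ‖Complex.sinh (((x / 2 : ℝ) : ℂ) + (((z.im + -kappa2 α) / 2 : ℝ) : ℂ) * Complex.I)‖ := by
    rw [← hκ]
    have hA : |(z.im + κ) / 2| = (z.im + κ) / 2 := abs_of_nonneg (by linarith)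
    have hB : |(z.im + -κ) / 2| = (κ - z.im) / 2 := by
      rw [abs_of_nonpos (by linarith)]; ring
    rcases le_total 0 z.im with h | h
    · refine mul_le_mul (hfar _ ?_ ?_) (hnear _ ?_ ?_) (by positivity) (norm_nonneg _) <;>
        first | rw [hA] | rw [hB]
      all_goals linarith
    · rw [mul_comm (m / 2 * (1 + |x|))]
      refine mul_le_mul (hnear _ ?_ ?_) (hfar _ ?_ ?_) (by positivity) (norm_nonneg _) <;>
        first | rw [hA] | rw [hB]
      all_goals linarith
  calc _ = 4 * b * (m / 2 * (1 + |x|) * ((|x| + δ) / 4)) := by ring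
    _ ≤ _ := by gcongr

theorem norm_inv_quadDenom_le {α b d : ℝ} (hα0 : 0 < α) (hα1 : α < 1) (hb : 0 < b)
    (hdk : d < kappa2 α) {z : ℂ} (hz : |z.im| ≤ d) :
    ‖(quadDenom α b z)⁻¹‖ ≤ 2 / (b * min α (1 - α)) *
      poleKernel ((kappa2 α - d) / (2 * Real.pi)) (z.re - Real.log b) := by
  have hm0 : 0 < min α (1 - α) := lt_min hα0 (by linarith)
  have hδ0 : 0 < (kappa2 α - d) / (2 * Real.pi) :=
    div_pos (by linarith) (by positivity)
  rw [norm_inv, poleKernel, ← inv_div, ← mul_inv]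
  gcongr
  exact le_norm_quadDenom hα0 hα1 hb hdk hz

theorem quadDenom_ne_zero {α b d : ℝ} (hα0 : 0 < α) (hα1 : α < 1) (hb : 0 < b)
    (hdk : d < kappa2 α) {z : ℂ} (hz : |z.im| ≤ d) : quadDenom α b z ≠ 0 := by
  have hm0 : 0 < min α (1 - α) := lt_min hα0 (by linarith)
  have hδ0 : 0 < (kappa2 α - d) / (2 * Real.pi) :=
    div_pos (by linarith) (by positivity)
  rw [← norm_pos_iff]
  exact lt_of_lt_of_le (by positivity) (le_norm_quadDenom hα0 hα1 hb hdk hz)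

theorem inv_quadDenom_ofReal (α b s : ℝ) :
    (quadDenom α b s)⁻¹ = (((Real.exp s + 2 * b * Real.cos (Real.pi * α) +
      b ^ 2 * Real.exp (-s))⁻¹ : ℝ) : ℂ) := by
  rw [quadDenom]
  push_cast
  rfl

/-! ## The Dunford integral -/

/-- The distance from `-1` to a sector: `1 + 2r cos ψ + r² ≥ 1 - 2r cos γ + r² = sin²γ + (r - cos
γ)²`. -/
theorem sin_le_norm_one_add {r ψ γ : ℝ} (hr : 0 ≤ r) (hγ0 : 0 ≤ γ) (hψ : |ψ| ≤ Real.pi - γ) :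
    Real.sin γ ≤ ‖1 + (r : ℂ) * Complex.exp (ψ * Complex.I)‖ := by
  have h1 : -Real.cos γ ≤ Real.cos ψ := by
    rw [← Real.cos_abs ψ, ← Real.cos_pi_sub]
    exact Real.cos_le_cos_of_nonneg_of_le_pi (abs_nonneg _) (by linarith) hψ
  have h2 : ‖1 + (r : ℂ) * Complex.exp (ψ * Complex.I)‖ ^ 2 = 1 + 2 * r * Real.cos ψ + r ^ 2 := by
    have e : 1 + (r : ℂ) * Complex.exp (ψ * Complex.I) =
        ((1 + r * Real.cos ψ : ℝ) : ℂ) + ((r * Real.sin ψ : ℝ) : ℂ) * Complex.I := by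
      rw [Complex.exp_mul_I]; push_cast; ring
    rw [e, Complex.sq_norm, Complex.normSq_add_mul_I]
    linear_combination r ^ 2 * Real.sin_sq_add_cos_sq ψ
  refine (le_abs_self _).trans (abs_le_of_sq_le_sq ?_ (norm_nonneg _))
  rw [h2]
  nlinarith [Real.sin_sq_add_cos_sq γ, sq_nonneg (r - Real.cos γ)]

theorem sin_le_norm_one_add_mul {ε γ : ℝ} {z : ℂ} (hε : 0 ≤ ε) (hγ0 : 0 ≤ γ)
    (hz : |z.arg| ≤ Real.pi - γ) : Real.sin γ ≤ ‖1 + (ε : ℂ) * z‖ := by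
  have h := sin_le_norm_one_add (r := ε * ‖z‖) (by positivity) hγ0 hz
  rwa [Complex.ofReal_mul, mul_assoc, Complex.norm_mul_exp_arg_mul_I] at h

/-- The argument is continuous on the slit plane and attains its maximal modulus on a compact set,
so a positive margin to `π` remains. -/
theorem exists_abs_arg_le {K : Set ℂ} (hK : IsCompact K) (hs : K ⊆ Complex.slitPlane) :
    ∃ γ, 0 < γ ∧ γ ≤ Real.pi / 2 ∧ ∀ z ∈ K, |z.arg| ≤ Real.pi - γ := by
  have hpi := Real.pi_pos
  rcases K.eq_empty_or_nonempty with rfl | hne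
  · exact ⟨Real.pi / 2, by positivity, le_rfl, by simp⟩
  have hc : ContinuousOn (fun z : ℂ => |z.arg|) K := fun z hz =>
    (Complex.continuousAt_arg (hs hz)).abs.continuousWithinAt
  obtain ⟨z₀, hz₀, hmax⟩ := hK.exists_isMaxOn hne hc
  have h0 : |z₀.arg| < Real.pi := by
    rw [abs_lt]
    exact ⟨Complex.neg_pi_lt_arg _, lt_of_le_of_ne (Complex.arg_le_pi _)
      (Complex.mem_slitPlane_iff_arg.1 (hs hz₀)).1⟩
  refine ⟨min (Real.pi - |z₀.arg|) (Real.pi / 2), lt_min (by linarith) (by positivity),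
    min_le_right _ _, fun z hz => ?_⟩
  have h1 : |z.arg| ≤ |z₀.arg| := hmax hz
  have h2 := min_le_left (Real.pi - |z₀.arg|) (Real.pi / 2)
  linarith

section DunfordIntegral

variable {A : Type*} [NormedRing A] [NormedAlgebra ℂ A]

/-- The Dunford integral `(1/(2πi)) ∮ f(z) (z - B)⁻¹ dz` over a circle. -/
noncomputable def dunfordIntegral (B : A) (c : ℂ) (R : ℝ) (f : ℂ → ℂ) : A :=
  (2 * (Real.pi : ℂ) * Complex.I)⁻¹ • circleIntegral (fun z : ℂ => f z • resolvent B z) c R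

theorem dunfordIntegral_congr {B : A} {c : ℂ} {R : ℝ} {f g : ℂ → ℂ} (hR : 0 ≤ R)
    (h : Set.EqOn f g (Metric.sphere c R)) : dunfordIntegral B c R f = dunfordIntegral B c R g := by
  rw [dunfordIntegral, dunfordIntegral]
  congr 1
  refine circleIntegral.integral_congr hR fun z hz => ?_
  simp only [h hz]

theorem sphere_subset_compl_ball {c : ℂ} {R : ℝ} : Metric.sphere c R ⊆ (Metric.ball c R)ᶜ :=
  fun z hz h => by
    rw [Metric.mem_sphere] at hz
    rw [Metric.mem_ball] at h
    linarith

theorem mem_resolventSet_of_notMem_ball {B : A} {c z : ℂ} {R : ℝ}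
    (hσ : spectrum ℂ B ⊆ Metric.ball c R) (hz : z ∈ (Metric.ball c R)ᶜ) : z ∈ resolventSet ℂ B := by
  by_contra h
  exact hz (hσ h)

theorem mul_resolvent {B : A} {z : ℂ} (hz : z ∈ resolventSet ℂ B) :
    B * resolvent B z = z • resolvent B z - 1 := by
  have h := Ring.mul_inverse_cancel _ (spectrum.mem_resolventSet_iff.1 hz)
  rw [sub_mul, ← Algebra.smul_def] at h
  rw [resolvent, ← h]
  abel

theorem dunfordIntegral_const_mul (B : A) (c : ℂ) (R : ℝ) (f : ℂ → ℂ) (a : ℂ) :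
    dunfordIntegral B c R (fun z => a * f z) = a • dunfordIntegral B c R f := by
  simp only [dunfordIntegral, mul_smul]
  rw [circleIntegral.integral_smul, smul_comm]

variable [CompleteSpace A]

theorem differentiableAt_resolvent {B : A} {c z : ℂ} {R : ℝ}
    (hσ : spectrum ℂ B ⊆ Metric.ball c R) (hz : z ∈ (Metric.ball c R)ᶜ) :
    DifferentiableAt ℂ (resolvent B) z :=
  (spectrum.hasDerivAt_resolvent_const_left
    (mem_resolventSet_of_notMem_ball hσ hz)).differentiableAt

theorem continuousOn_resolvent {B : A} {c : ℂ} {R : ℝ} (hσ : spectrum ℂ B ⊆ Metric.ball c R) :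
    ContinuousOn (resolvent B) (Metric.ball c R)ᶜ := fun _ hz =>
  (differentiableAt_resolvent hσ hz).continuousAt.continuousWithinAt

theorem circleIntegrable_smul_resolvent {B : A} {c : ℂ} {R : ℝ} {f : ℂ → ℂ} (hR : 0 ≤ R)
    (hσ : spectrum ℂ B ⊆ Metric.ball c R) (hf : ContinuousOn f (Metric.sphere c R)) :
    CircleIntegrable (fun z => f z • resolvent B z) c R :=
  (hf.smul ((continuousOn_resolvent hσ).mono sphere_subset_compl_ball)).circleIntegrable hR

theorem dunfordIntegral_add {B : A} {c : ℂ} {R : ℝ} {f g : ℂ → ℂ} (hR : 0 ≤ R)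
    (hσ : spectrum ℂ B ⊆ Metric.ball c R) (hf : ContinuousOn f (Metric.sphere c R))
    (hg : ContinuousOn g (Metric.sphere c R)) :
    dunfordIntegral B c R (fun z => f z + g z) =
      dunfordIntegral B c R f + dunfordIntegral B c R g := by
  simp only [dunfordIntegral, add_smul]
  rw [circleIntegral.integral_add (circleIntegrable_smul_resolvent hR hσ hf)
    (circleIntegrable_smul_resolvent hR hσ hg), smul_add]


theorem mul_circleIntegral (B : A) {c : ℂ} {R : ℝ} {F : ℂ → A} (hF : CircleIntegrable F c R) :
    B * circleIntegral F c R = circleIntegral (fun z => B * F z) c R := by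
  have h := (ContinuousLinearMap.mul ℂ A B).intervalIntegral_comp_comm hF.out
  simp only [ContinuousLinearMap.mul_apply', mul_smul_comm] at h
  exact h.symm

/-- Since `B (z - B)⁻¹ = z (z - B)⁻¹ - 1`, the two sides differ by a multiple of `∮ f`, which
vanishes by Cauchy's theorem. -/
theorem mul_dunfordIntegral {B : A} {c : ℂ} {R : ℝ} {f : ℂ → ℂ} (hR : 0 ≤ R)
    (hσ : spectrum ℂ B ⊆ Metric.ball c R) (hf : DifferentiableOn ℂ f (Metric.closedBall c R)) :
    B * dunfordIntegral B c R f = dunfordIntegral B c R (fun z => z * f z) := by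
  have hfs : ContinuousOn f (Metric.sphere c R) :=
    hf.continuousOn.mono Metric.sphere_subset_closedBall
  have hcauchy : circleIntegral f c R = 0 :=
    Complex.circleIntegral_eq_zero_of_differentiable_on_off_countable hR Set.countable_empty
      hf.continuousOn fun z hz =>
        (hf z (Metric.ball_subset_closedBall hz.1)).differentiableAt
          (Metric.closedBall_mem_nhds_of_mem hz.1)
  rw [dunfordIntegral, dunfordIntegral, mul_smul_comm,
    mul_circleIntegral B (circleIntegrable_smul_resolvent hR hσ hfs)]
  congr 1
  have h1 : circleIntegral (fun z => B * f z • resolvent B z) c R =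
      circleIntegral (fun z => (z * f z) • resolvent B z - f z • (1 : A)) c R := by
    refine circleIntegral.integral_congr hR fun z hz => ?_
    rw [mul_smul_comm, mul_resolvent (mem_resolventSet_of_notMem_ball hσ
      (sphere_subset_compl_ball hz)), smul_sub, smul_smul, mul_comm z]
  have h2 : CircleIntegrable (fun z => f z • (1 : A)) c R :=
    ContinuousOn.circleIntegrable hR (hfs.smul continuousOn_const)
  rw [h1, circleIntegral.integral_sub (circleIntegrable_smul_resolvent (f := fun z => z * f z) hR hσ
    (continuousOn_id.mul hfs)) h2, circleIntegral.integral_smul_const,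
    hcauchy, zero_smul, sub_zero]

/-- The integral is the same over all larger circles, and the resolvent differs from `(z - c)⁻¹` by
`(z - c)⁻¹ (B - c)(z - B)⁻¹`. The integral of this remainder tends to zero with the resolvent at
infinity. -/
theorem circleIntegral_resolvent {B : A} {c : ℂ} {R : ℝ} (hR : 0 < R)
    (hσ : spectrum ℂ B ⊆ Metric.ball c R) :
    circleIntegral (resolvent B) c R = (2 * (Real.pi : ℂ) * Complex.I) • (1 : A) := by
  have hσ' : ∀ r, R ≤ r → spectrum ℂ B ⊆ Metric.ball c r := fun r hr =>
    hσ.trans (Metric.ball_subset_ball hr)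
  have hindep : ∀ r, R ≤ r → circleIntegral (resolvent B) c r = circleIntegral (resolvent B) c R := by
    intro r hr
    have hsub : ∀ z ∈ (Metric.ball c R)ᶜ, z - c ≠ 0 := by
      intro z hz h0
      rw [sub_eq_zero] at h0
      exact hz (by rw [h0]; exact Metric.mem_ball_self hR)
    -- Cauchy's theorem on an annulus is stated with a factor `(z - c)⁻¹`, so this factor is
    -- inserted and compensated.
    have hcancel : ∀ r, R ≤ r → circleIntegral (fun z => (z - c)⁻¹ • ((z - c) • resolvent B z)) c r =
        circleIntegral (resolvent B) c r := by
      intro r hr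
      refine circleIntegral.integral_congr (hR.le.trans hr) fun z hz => ?_
      have hz' : z ∈ (Metric.ball c R)ᶜ := fun h =>
        sphere_subset_compl_ball hz (Metric.ball_subset_ball hr h)
      exact inv_smul_smul₀ (hsub z hz') _
    rw [← hcancel r hr, ← hcancel R le_rfl]
    refine Complex.circleIntegral_sub_center_inv_smul_eq_of_differentiable_on_annulus_off_countable
      hR hr Set.countable_empty ?_ ?_
    · exact (by fun_prop : Continuous fun z : ℂ => z - c).continuousOn.smul
        ((continuousOn_resolvent hσ).mono fun z hz => hz.2)
    · intro z hz
      have hz' : z ∈ (Metric.ball c R)ᶜ := fun h => hz.1.2 (Metric.ball_subset_closedBall h)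
      exact (by fun_prop : DifferentiableAt ℂ (fun z : ℂ => z - c) z).smul
        (differentiableAt_resolvent hσ hz')
  set D : A := B - algebraMap ℂ A c with hD
  have hdiff : ∀ r, R ≤ r → circleIntegral (resolvent B) c R -
      (2 * (Real.pi : ℂ) * Complex.I) • (1 : A) =
      circleIntegral (fun z => (z - c)⁻¹ • (D * resolvent B z)) c r := by
    intro r hr
    have hr0 : 0 < r := hR.trans_le hr
    have h1 : circleIntegral (fun z => (z - c)⁻¹ • (1 : A)) c r =
        (2 * (Real.pi : ℂ) * Complex.I) • (1 : A) := by
      rw [circleIntegral.integral_smul_const, circleIntegral.integral_sub_center_inv c hr0.ne']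
    have hne : ∀ z ∈ Metric.sphere c r, z - c ≠ 0 := by
      intro z hz h0
      rw [mem_sphere_iff_norm, h0, norm_zero] at hz
      linarith
    rw [← hindep r hr, ← h1, ← circleIntegral.integral_sub]
    · refine circleIntegral.integral_congr hr0.le fun z hz => ?_
      have hz' := mem_resolventSet_of_notMem_ball (hσ' r hr) (sphere_subset_compl_ball hz)
      rw [hD, sub_mul, mul_resolvent hz', ← Algebra.smul_def]
      have e : z • resolvent B z - 1 - c • resolvent B z = (z - c) • resolvent B z - 1 := by
        rw [sub_smul]; abel
      rw [e, smul_sub, inv_smul_smul₀ (hne z hz)]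
    · exact ((continuousOn_resolvent (hσ' r hr)).mono sphere_subset_compl_ball).circleIntegrable
        hr0.le
    · refine ContinuousOn.circleIntegrable hr0.le (ContinuousOn.smul ?_ continuousOn_const)
      exact ContinuousOn.inv₀ (by fun_prop) hne
  refine sub_eq_zero.1 (norm_le_zero_iff.1 (le_of_forall_pos_le_add fun ε hε => ?_))
  set η := ε / (2 * Real.pi * (‖D‖ + 1)) with hη
  have hη0 : 0 < η := by positivity
  have hev := (spectrum.resolvent_tendsto_cobounded (𝕜 := ℂ) B).norm
  rw [norm_zero] at hev
  have hev2 := hev.eventually (eventually_lt_nhds hη0)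
  rw [← comap_norm_atTop, eventually_comap] at hev2
  obtain ⟨N, hN⟩ := eventually_atTop.1 hev2
  -- A circle of this radius about `c` lies outside the ball of radius `N` about 0, where the
  -- resolvent exceeds no longer `η`.
  set r := max R (N + ‖c‖) with hr
  have hRr : R ≤ r := le_max_left _ _
  have hr0 : 0 < r := hR.trans_le hRr
  rw [hdiff r hRr, zero_add]
  have hb : ∀ z ∈ Metric.sphere c r, ‖(z - c)⁻¹ • (D * resolvent B z)‖ ≤ r⁻¹ * (‖D‖ * η) := by
    intro z hz
    have hzc : ‖z - c‖ = r := mem_sphere_iff_norm.1 hz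
    have hzN : N ≤ ‖z‖ := by
      have h1 : N + ‖c‖ ≤ r := le_max_right _ _
      have h2 := norm_sub_le z c
      linarith
    rw [norm_smul, norm_inv, hzc]
    gcongr
    exact (norm_mul_le _ _).trans (by gcongr; exact (hN _ hzN z rfl).le)
  refine (circleIntegral.norm_integral_le_of_norm_le_const hr0.le hb).trans ?_
  have e : 2 * Real.pi * r * (r⁻¹ * (‖D‖ * η)) = ε * (‖D‖ / (‖D‖ + 1)) := by
    rw [hη]
    have : ‖D‖ + 1 ≠ 0 := by positivity
    field_simp
  rw [e]
  have : ‖D‖ / (‖D‖ + 1) ≤ 1 := by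
    rw [div_le_one (by positivity)]; linarith
  nlinarith

theorem dunfordIntegral_one {B : A} {c : ℂ} {R : ℝ} (hR : 0 < R)
    (hσ : spectrum ℂ B ⊆ Metric.ball c R) : dunfordIntegral B c R (fun _ => 1) = 1 := by
  simp only [dunfordIntegral, one_smul]
  rw [circleIntegral_resolvent hR hσ]
  exact inv_smul_smul₀ Complex.two_pi_I_ne_zero _

/-- Multiplication by `B` alone suffices here: full multiplicativity of the functional calculus is
avoided, since only products with `1 + eB` have to be identified. -/
theorem one_add_smul_mul_dunfordIntegral {B : A} {c : ℂ} {R : ℝ} {f : ℂ → ℂ} (hR : 0 ≤ R)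
    (hσ : spectrum ℂ B ⊆ Metric.ball c R) (hf : DifferentiableOn ℂ f (Metric.closedBall c R))
    {e : ℂ} (he : ∀ z ∈ Metric.closedBall c R, 1 + e * z ≠ 0) :
    (1 + e • B) * dunfordIntegral B c R (fun z => (1 + e * z)⁻¹ * f z) =
      dunfordIntegral B c R f := by
  set g : ℂ → ℂ := fun z => (1 + e * z)⁻¹ * f z with hg
  have hgd : DifferentiableOn ℂ g (Metric.closedBall c R) :=
    (DifferentiableOn.inv (by fun_prop) he).mul hf
  have hgs := hgd.continuousOn.mono (Metric.sphere_subset_closedBall (x := c) (ε := R))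
  rw [add_mul, one_mul, smul_mul_assoc, mul_dunfordIntegral hR hσ hgd,
    ← dunfordIntegral_const_mul, ← dunfordIntegral_add (g := fun z => e * (z * g z)) hR hσ hgs
      (continuousOn_const.mul (continuousOn_id.mul hgs))]
  refine dunfordIntegral_congr hR fun z hz => ?_
  have := he z (Metric.sphere_subset_closedBall hz)
  simp only [hg]
  field_simp

/-- Fubini. The disc is compact in the slit plane, so `|1 + e(s) z| ≥ sin γ` uniformly in `s` and
`z`, and `|k(s)|` times a continuous function on the circle dominates. -/
theorem integral_smul_dunfordIntegral {B : A} {c : ℂ} {R : ℝ} {f : ℂ → ℂ} (hR : 0 ≤ R)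
    (hσ : spectrum ℂ B ⊆ Metric.ball c R) (hf : ContinuousOn f (Metric.sphere c R))
    (hs : Metric.closedBall c R ⊆ Complex.slitPlane) {k : ℝ → ℂ} (hk : Integrable k)
    (hkc : Continuous k) {e : ℝ → ℝ} (he : ∀ s, 0 ≤ e s) (hec : Continuous e) :
    ∫ s, k s • dunfordIntegral B c R (fun z => (1 + (e s : ℂ) * z)⁻¹ * f z) =
      dunfordIntegral B c R (fun z => (∫ s, k s * (1 + (e s : ℂ) * z)⁻¹) * f z) := by
  obtain ⟨γ, hγ0, hγ1, hγ⟩ := exists_abs_arg_le (isCompact_closedBall c R) hs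
  have hsin : 0 < Real.sin γ := Real.sin_pos_of_pos_of_lt_pi hγ0 (by linarith [Real.pi_pos])
  have hmem : ∀ θ, circleMap c R θ ∈ Metric.sphere c R := circleMap_mem_sphere c hR
  have hlow : ∀ s θ, Real.sin γ ≤ ‖1 + (e s : ℂ) * circleMap c R θ‖ := fun s θ =>
    sin_le_norm_one_add_mul (he s) hγ0.le (hγ _ (Metric.sphere_subset_closedBall (hmem θ)))
  have hcirc : Continuous (circleMap c R) := continuous_circleMap c R
  have hfc : Continuous fun θ => f (circleMap c R θ) := by
    rw [← continuousOn_univ]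
    exact hf.comp hcirc.continuousOn fun θ _ => hmem θ
  have hrc : Continuous fun θ => resolvent B (circleMap c R θ) := by
    rw [← continuousOn_univ]
    exact (continuousOn_resolvent hσ).comp hcirc.continuousOn fun θ _ =>
      sphere_subset_compl_ball (hmem θ)
  set H : ℝ → A := fun θ => f (circleMap c R θ) • resolvent B (circleMap c R θ) with hH
  have hHc : Continuous H := hfc.smul hrc
  set G : ℝ → ℝ → A := fun θ s => deriv (circleMap c R) θ •
    ((k s * (1 + (e s : ℂ) * circleMap c R θ)⁻¹) • H θ) with hG
  have hderc : Continuous (deriv (circleMap c R)) := by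
    have : deriv (circleMap c R) = fun θ => circleMap 0 R θ * Complex.I := by
      ext θ; exact deriv_circleMap c R θ
    rw [this]
    exact (continuous_circleMap 0 R).mul continuous_const
  have hGc : Continuous (Function.uncurry G) := by
    refine (hderc.comp continuous_fst).smul (Continuous.smul ?_ (hHc.comp continuous_fst))
    refine (hkc.comp continuous_snd).mul (Continuous.inv₀ ?_ ?_)
    · have h1 := hec.comp (continuous_snd (X := ℝ) (Y := ℝ))
      have h2 := hcirc.comp (continuous_fst (X := ℝ) (Y := ℝ))
      exact continuous_const.add ((Complex.continuous_ofReal.comp h1).mul h2)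
    · rintro ⟨θ, s⟩
      exact norm_pos_iff.1 (hsin.trans_le (hlow s θ))
  have hGint : Integrable (Function.uncurry G)
      ((volume.restrict (Set.uIoc 0 (2 * Real.pi))).prod volume) := by
    have h1 : Integrable (fun θ => R * (Real.sin γ)⁻¹ * ‖H θ‖)
        (volume.restrict (Set.uIoc 0 (2 * Real.pi))) := by
      have : Continuous fun θ => R * (Real.sin γ)⁻¹ * ‖H θ‖ := by fun_prop
      exact (intervalIntegrable_iff.1 (this.intervalIntegrable 0 (2 * Real.pi)))
    refine (h1.mul_prod hk.norm).mono' hGc.aestronglyMeasurable (Eventually.of_forall ?_)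
    rintro ⟨θ, s⟩
    simp only [Function.uncurry, hG, norm_smul, norm_mul, norm_inv, deriv_circleMap,
      norm_circleMap_zero, Complex.norm_I, mul_one, abs_of_nonneg hR]
    have := hlow s θ
    calc _ ≤ R * (‖k s‖ * (Real.sin γ)⁻¹ * ‖H θ‖) := by gcongr
      _ = _ := by ring
  have hswap := intervalIntegral_integral_swap hGint
  simp only [dunfordIntegral, circleIntegral]
  have hl : ∀ s, k s • (2 * (Real.pi : ℂ) * Complex.I)⁻¹ • (∫ θ in (0:ℝ)..2 * Real.pi,
      deriv (circleMap c R) θ • ((1 + (e s : ℂ) * circleMap c R θ)⁻¹ * f (circleMap c R θ)) •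
        resolvent B (circleMap c R θ)) =
      (2 * (Real.pi : ℂ) * Complex.I)⁻¹ • ∫ θ in (0:ℝ)..2 * Real.pi, G θ s := by
    intro s
    rw [smul_comm, ← intervalIntegral.integral_smul]
    congr 2
    ext θ
    simp only [hG, hH, smul_smul]
    congr 1
    ring
  simp only [hl]
  rw [integral_smul, ← hswap]
  congr 1
  refine intervalIntegral.integral_congr fun θ _ => ?_
  simp only [hG, hH]
  rw [integral_smul, integral_smul_const, mul_smul]

end DunfordIntegral

/-! ## Sectorial operators on a finite-dimensional space -/

theorem abs_arg_le_arctan {q : ℂ} {β : ℝ} (hβ : 0 ≤ β) (hre : 0 ≤ q.re) (h : |q.im| ≤ β * q.re) :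
    |q.arg| ≤ Real.arctan β := by
  -- If `Re q = 0`, the sector condition forces `q = 0`, whose argument is 0 by convention.
  rcases hre.eq_or_lt with h0 | h0
  · rw [← h0, mul_zero] at h
    have : q = 0 := Complex.ext h0.symm (abs_nonpos_iff.1 h)
    simp [this, Real.arctan_nonneg.2 hβ]
  · have h1 : |q.arg| < Real.pi / 2 := Complex.abs_arg_lt_pi_div_two_iff.2 (Or.inl h0)
    rw [abs_lt] at h1
    have h2 : q.arg = Real.arctan (q.im / q.re) := by
      rw [← Complex.tan_arg, Real.arctan_tan h1.1 h1.2]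
    rw [abs_le] at h ⊢
    rw [h2, ← Real.arctan_neg]
    constructor
    · refine Real.arctan_strictMono.monotone ?_
      rw [le_div_iff₀ h0]; linarith
    · refine Real.arctan_strictMono.monotone ?_
      rw [div_le_iff₀ h0]; linarith

section SectorialOperator

variable {W : Type*} [NormedAddCommGroup W] [InnerProductSpace ℂ W]

theorem isUnit_of_antilipschitz [FiniteDimensional ℂ W] {T : W →L[ℂ] W} {σ : ℝ} (hσ : 0 < σ)
    (h : ∀ v, σ * ‖v‖ ≤ ‖T v‖) : IsUnit T := by
  have : CompleteSpace W := FiniteDimensional.complete ℂ W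
  have hinj : Function.Injective T := by
    refine (injective_iff_map_eq_zero T).2 fun v hv => ?_
    have := h v
    rw [hv, norm_zero] at this
    exact norm_le_zero_iff.1 (by nlinarith [norm_nonneg v])
  rw [ContinuousLinearMap.isUnit_iff_bijective]
  exact ⟨hinj, (LinearMap.injective_iff_surjective (f := (T : W →ₗ[ℂ] W))).1 hinj⟩

theorem norm_inverse_apply_le {T : W →L[ℂ] W} {σ : ℝ} (hσ : 0 < σ)
    (h : ∀ v, σ * ‖v‖ ≤ ‖T v‖) (hT : IsUnit T) (f : W) : ‖Ring.inverse T f‖ ≤ σ⁻¹ * ‖f‖ := by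
  have h1 := h (Ring.inverse T f)
  have h2 : T (Ring.inverse T f) = f := by
    have := congrArg (fun S : W →L[ℂ] W => S f) (Ring.mul_inverse_cancel T hT)
    simpa using this
  rw [h2] at h1
  rwa [inv_mul_eq_div, le_div_iff₀' hσ]

theorem mul_norm_le_of_inner {T : W →L[ℂ] W} {σ : ℝ} {v : W}
    (h : σ * ‖v‖ ^ 2 ≤ ‖inner ℂ v (T v)‖) : σ * ‖v‖ ≤ ‖T v‖ := by
  rcases eq_or_ne v 0 with rfl | hv
  · simp
  · have hv0 : 0 < ‖v‖ := norm_pos_iff.2 hv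
    have h1 := norm_inner_le_norm (𝕜 := ℂ) v (T v)
    refine le_of_mul_le_mul_left ?_ hv0
    nlinarith

/-- The operator `B` is coercive with numerical range in the sector `|arg z| ≤ arctan β`. -/
structure IsSectorial (β c₀ : ℝ) (B : W →L[ℂ] W) : Prop where
  nonneg : 0 ≤ β
  pos : 0 < c₀
  coercive : ∀ v, c₀ * ‖v‖ ^ 2 ≤ (inner ℂ v (B v)).re
  sector : ∀ v, |(inner ℂ v (B v)).im| ≤ β * (inner ℂ v (B v)).re

namespace IsSectorial

variable {β c₀ : ℝ} {B : W →L[ℂ] W}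

/-- With `q = (Bv, v)`, testing against `v` gives `‖v‖² (1 + ρ e^{i(arg q - Im z)})` for some `ρ ≥
0`. Since `|arg q| ≤ arctan β`, the angle stays at distance `γ` from `±π`, and the distance from
`-1` to the sector applies. -/
theorem sin_mul_norm_le (hB : IsSectorial β c₀ B) {γ : ℝ} {z : ℂ} (hγ0 : 0 ≤ γ)
    (hz : |z.im| + Real.arctan β ≤ Real.pi - γ) (v : W) :
    Real.sin γ * ‖v‖ ≤ ‖(1 + Complex.exp (-z) • B) v‖ := by
  refine mul_norm_le_of_inner ?_
  rcases eq_or_ne v 0 with rfl | hv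
  · simp
  have hv0 : 0 < ‖v‖ := norm_pos_iff.2 hv
  have hvc : (‖v‖ : ℂ) ≠ 0 := by exact_mod_cast hv0.ne'
  set q : ℂ := inner ℂ v (B v) with hq
  have hre : 0 ≤ q.re := le_trans (by have := hB.pos; positivity) (hB.coercive v)
  have harg := abs_arg_le_arctan hB.nonneg hre (hB.sector v)
  have hψ : |q.arg - z.im| ≤ Real.pi - γ := (abs_sub _ _).trans (by linarith)
  have h := sin_le_norm_one_add (r := Real.exp (-z.re) * ‖q‖ / ‖v‖ ^ 2) (by positivity) hγ0 hψ
  have e : inner ℂ v ((1 + Complex.exp (-z) • B) v) = ((‖v‖ ^ 2 : ℝ) : ℂ) *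
      (1 + ((Real.exp (-z.re) * ‖q‖ / ‖v‖ ^ 2 : ℝ) : ℂ) *
        Complex.exp ((q.arg - z.im : ℝ) * Complex.I)) := by
    have h1 : inner ℂ v ((1 + Complex.exp (-z) • B) v) = (‖v‖ : ℂ) ^ 2 + Complex.exp (-z) * q := by
      simp [hq]
    have h2 : Complex.exp (-z) = (Real.exp (-z.re) : ℂ) * Complex.exp (-(z.im * Complex.I)) := by
      rw [Complex.ofReal_exp, ← Complex.exp_add]
      congr 1
      apply Complex.ext <;> simp
    have h3 : Complex.exp ((q.arg - z.im : ℝ) * Complex.I) =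
        Complex.exp (q.arg * Complex.I) * Complex.exp (-(z.im * Complex.I)) := by
      rw [← Complex.exp_add]; congr 1; push_cast; ring
    have h4 := Complex.norm_mul_exp_arg_mul_I q
    rw [h1, h2, h3]
    generalize Complex.exp (q.arg * Complex.I) = w₁ at h4
    generalize Complex.exp (-(z.im * Complex.I)) = w₂
    push_cast
    field_simp
    linear_combination -(Complex.exp (-(z.re : ℂ)) * w₂) * h4
  rw [e, norm_mul, Complex.norm_real, Real.norm_of_nonneg (by positivity), mul_comm]
  gcongr

theorem isUnit_one_add [FiniteDimensional ℂ W] (hB : IsSectorial β c₀ B) {γ : ℝ} {z : ℂ}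
    (hγ0 : 0 < γ) (hγ1 : γ ≤ Real.pi / 2) (hz : |z.im| + Real.arctan β ≤ Real.pi - γ) :
    IsUnit (1 + Complex.exp (-z) • B) :=
  isUnit_of_antilipschitz (Real.sin_pos_of_pos_of_lt_pi hγ0 (by linarith [Real.pi_pos]))
    (hB.sin_mul_norm_le hγ0.le hz)

theorem norm_inverse_le [FiniteDimensional ℂ W] (hB : IsSectorial β c₀ B) {γ : ℝ} {z : ℂ}
    (hγ0 : 0 < γ) (hγ1 : γ ≤ Real.pi / 2) (hz : |z.im| + Real.arctan β ≤ Real.pi - γ) (f : W) :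
    ‖Ring.inverse (1 + Complex.exp (-z) • B) f‖ ≤ (Real.sin γ)⁻¹ * ‖f‖ :=
  norm_inverse_apply_le (Real.sin_pos_of_pos_of_lt_pi hγ0 (by linarith [Real.pi_pos]))
    (hB.sin_mul_norm_le hγ0.le hz) (hB.isUnit_one_add hγ0 hγ1 hz) f

theorem le_re_of_mem_spectrum [FiniteDimensional ℂ W] (hB : IsSectorial β c₀ B) {z : ℂ}
    (hz : z ∈ spectrum ℂ B) : c₀ ≤ z.re := by
  by_contra hlt
  push Not at hlt
  refine spectrum.mem_iff.1 hz (isUnit_of_antilipschitz (σ := c₀ - z.re) (by linarith) fun v => ?_)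
  refine mul_norm_le_of_inner ?_
  have e : (inner ℂ v ((algebraMap ℂ (W →L[ℂ] W) z - B) v)).re =
      z.re * ‖v‖ ^ 2 - (inner ℂ v (B v)).re := by
    have h1 : (algebraMap ℂ (W →L[ℂ] W) z) v = z • v := by
      rw [Algebra.algebraMap_eq_smul_one]; simp
    rw [sub_apply, h1, inner_sub_right, inner_smul_right,
      inner_self_eq_norm_sq_to_K, Complex.sub_re]
    congr 1
    simp [← Complex.ofReal_pow]
  have h2 := Complex.abs_re_le_norm (inner ℂ v ((algebraMap ℂ (W →L[ℂ] W) z - B) v))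
  have h3 := neg_abs_le (inner ℂ v ((algebraMap ℂ (W →L[ℂ] W) z - B) v)).re
  rw [e] at h2 h3
  have := hB.coercive v
  linarith

/-- The spectrum lies in `Re z ≥ c₀`, `|z| ≤ N`. A circle through `c₀/2` with a centre `ρ` far out
on the positive axis contains this region, because `|z - ρ|² ≤ N² - 2ρc₀ + ρ² < (ρ - c₀/2)²` once
`N² < ρc₀`. -/
theorem exists_isDunfordContour [FiniteDimensional ℂ W] (hB : IsSectorial β c₀ B) :
    ∃ p : ℂ × ℝ, IsDunfordContour B p := by
  have : CompleteSpace W := FiniteDimensional.complete ℂ W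
  have hc := hB.pos
  -- The norm of the identity is kept because it is 0, not 1, on the trivial space.
  set N := ‖B‖ * ‖(1 : W →L[ℂ] W)‖ with hN
  have hN0 : 0 ≤ N := by positivity
  set ρ := N ^ 2 / c₀ + c₀ with hρ
  have hρ1 : N ^ 2 < ρ * c₀ := by
    have : ρ * c₀ = N ^ 2 + c₀ ^ 2 := by rw [hρ]; field_simp
    rw [this]; nlinarith
  have hρ2 : c₀ ≤ ρ := by
    have : 0 ≤ N ^ 2 / c₀ := by positivity
    linarith
  refine ⟨((ρ : ℂ), ρ - c₀ / 2), by simp only; linarith, fun z hz => ?_, fun z hz => ?_⟩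
  · rw [Metric.mem_closedBall, dist_eq_norm] at hz
    have h1 := (Complex.abs_re_le_norm _).trans hz
    rw [Complex.sub_re, Complex.ofReal_re, abs_le] at h1
    exact Or.inl (by simp only at h1; linarith [h1.1])
  · have h1 := hB.le_re_of_mem_spectrum hz
    have h2 : ‖z‖ ≤ N := spectrum.norm_le_norm_mul_of_mem hz
    rw [Metric.mem_ball, dist_eq_norm]
    simp only
    refine lt_of_pow_lt_pow_left₀ 2 (by linarith) ?_
    have h3 : ‖z - ρ‖ ^ 2 = ‖z‖ ^ 2 - 2 * ρ * z.re + ρ ^ 2 := by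
      rw [Complex.sq_norm, Complex.sq_norm, Complex.normSq_apply, Complex.normSq_apply]
      simp
      ring
    have h4 : ‖z‖ ^ 2 ≤ N ^ 2 := by gcongr
    rw [h3]
    nlinarith

end IsSectorial

/-! ### The operator integral representation. -/

theorem shiftedPower_eq_dunfordIntegral [CompleteSpace W] (α b : ℝ) {B : W →L[ℂ] W}
    (h : ∃ p : ℂ × ℝ, IsDunfordContour B p) :
    ∃ p : ℂ × ℝ, IsDunfordContour B p ∧
      shiftedPower α b B = dunfordIntegral B p.1 p.2 (fun z => z ^ (α : ℂ) + b) := by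
  obtain ⟨hR, hs, hσ⟩ := h.choose_spec
  -- The circle is the very one chosen in `dunfordPower`, so independence of the contour is not
  -- needed.
  refine ⟨h.choose, h.choose_spec, ?_⟩
  have hpow : ContinuousOn (fun z : ℂ => z ^ (α : ℂ)) (Metric.sphere h.choose.1 h.choose.2) :=
    fun z hz => (continuousAt_cpow_const
      (hs (Metric.sphere_subset_closedBall hz))).continuousWithinAt
  rw [dunfordIntegral_add hR.le hσ hpow continuousOn_const, shiftedPower, dunfordPower, dif_pos h]
  have h1 := dunfordIntegral_const_mul B h.choose.1 h.choose.2 (fun _ => 1) (b : ℂ)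
  simp only [mul_one] at h1
  rw [h1, dunfordIntegral_one hR hσ]
  rfl

theorem continuous_inv_quadDenom_ofReal {α b : ℝ} (hα0 : 0 < α) (hα1 : α < 1) (hb : 0 < b) :
    Continuous fun s : ℝ => (quadDenom α b s)⁻¹ := by
  have hk : 0 < kappa2 α := mul_pos (by linarith) Real.pi_pos
  refine Continuous.inv₀ ?_ fun s => quadDenom_ne_zero hα0 hα1 hb hk (by simp)
  unfold quadDenom
  fun_prop

theorem delta_mem {α d : ℝ} (hα0 : 0 < α) (hd0 : 0 ≤ d) (hdk : d < kappa2 α) :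
    0 < (kappa2 α - d) / (2 * Real.pi) ∧ (kappa2 α - d) / (2 * Real.pi) ≤ 1 / 2 := by
  have hpi := Real.pi_pos
  refine ⟨div_pos (by linarith) (by positivity), ?_⟩
  rw [div_le_iff₀ (by positivity)]
  have : kappa2 α = (1 - α) * Real.pi := rfl
  nlinarith

theorem integrable_inv_quadDenom_ofReal {α b : ℝ} (hα0 : 0 < α) (hα1 : α < 1) (hb : 0 < b) :
    Integrable fun s : ℝ => (quadDenom α b s)⁻¹ := by
  have hk : 0 < kappa2 α := mul_pos (by linarith) Real.pi_pos
  obtain ⟨h1, h2⟩ := delta_mem hα0 le_rfl hk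
  have h := ((integrable_poleKernel h1 (by linarith)).comp_sub_right (Real.log b)).const_mul
    (2 / (b * min α (1 - α)))
  refine h.mono' (continuous_inv_quadDenom_ofReal hα0 hα1 hb).aestronglyMeasurable
    (Eventually.of_forall fun s => ?_)
  simpa using norm_inv_quadDenom_le hα0 hα1 hb hk (z := s) (by simp)

theorem resolventFactor_eq (α s : ℝ) (B : W →L[ℂ] W) :
    resolventFactor α s B = 1 + Complex.exp (-(((s / α : ℝ) : ℂ))) • B := by
  rw [resolventFactor, neg_div, Complex.ofReal_exp, Complex.ofReal_neg]

theorem quadIntegrand_eq (α b s : ℝ) (B : W →L[ℂ] W) (f : W) :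
    quadIntegrand α b B f s = (quadDenom α b s)⁻¹ • Ring.inverse (resolventFactor α s B) f := by
  rw [quadIntegrand, inv_quadDenom_ofReal]

/-- On the real line the angular margin can be taken as `γ = π/2`, and since `sin γ = 1` the
inverses there are contractions. -/
theorem abs_im_ofReal_add_arctan_le (β s α : ℝ) :
    |((s / α : ℝ) : ℂ).im| + Real.arctan β ≤ Real.pi - Real.pi / 2 := by
  have := (Real.arctan_lt_pi_div_two β).le
  rw [Complex.ofReal_im, abs_zero]
  linarith

namespace IsSectorial

variable {β c₀ α b : ℝ} {B : W →L[ℂ] W} [FiniteDimensional ℂ W]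

theorem isUnit_resolventFactor (hB : IsSectorial β c₀ B) (α s : ℝ) :
    IsUnit (resolventFactor α s B) := by
  rw [resolventFactor_eq]
  exact hB.isUnit_one_add (by positivity) le_rfl (abs_im_ofReal_add_arctan_le β s α)

theorem norm_inverse_resolventFactor_le (hB : IsSectorial β c₀ B) (α s : ℝ) (f : W) :
    ‖Ring.inverse (resolventFactor α s B) f‖ ≤ ‖f‖ := by
  rw [resolventFactor_eq]
  simpa using hB.norm_inverse_le (by positivity) le_rfl (abs_im_ofReal_add_arctan_le β s α) f

theorem integrable_smul_inverse (hB : IsSectorial β c₀ B) (hα0 : 0 < α) (hα1 : α < 1)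
    (hb : 0 < b) :
    Integrable fun s : ℝ => (quadDenom α b s)⁻¹ • Ring.inverse (resolventFactor α s B) := by
  have : CompleteSpace W := FiniteDimensional.complete ℂ W
  refine (integrable_inv_quadDenom_ofReal hα0 hα1 hb).norm.mono'
    (Continuous.aestronglyMeasurable ?_) (Eventually.of_forall fun s => ?_)
  · refine (continuous_inv_quadDenom_ofReal hα0 hα1 hb).smul ?_
    refine continuous_iff_continuousAt.2 fun s => ?_
    have h1 : Continuous fun s : ℝ => resolventFactor α s B := by
      unfold resolventFactor; fun_prop
    obtain ⟨u, hu⟩ := hB.isUnit_resolventFactor α s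
    have h2 := NormedRing.inverse_continuousAt u
    rw [hu] at h2
    exact ContinuousAt.comp (f := fun s : ℝ => resolventFactor α s B) h2 h1.continuousAt
  · rw [norm_smul]
    refine mul_le_of_le_one_right (norm_nonneg _) ?_
    exact ContinuousLinearMap.opNorm_le_bound _ zero_le_one fun f => by
      rw [one_mul]; exact hB.norm_inverse_resolventFactor_le α s f

/-- Under the `s`-integral, the inverse times the Dunford integral of `z^α + b` is the Dunford
integral of `(1 + e^{-s/α} z)⁻¹ (z^α + b)`. After exchanging the integrals, the scalar
representation makes the function constant, and the Dunford integral of 1 is the identity. -/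
theorem integral_smul_inverse_mul_shiftedPower (hB : IsSectorial β c₀ B) (hα0 : 0 < α)
    (hα1 : α < 1) (hb : 0 < b) :
    (∫ s : ℝ, (quadDenom α b s)⁻¹ • Ring.inverse (resolventFactor α s B)) * shiftedPower α b B =
      ((α * Real.pi / Real.sin (Real.pi * α) : ℝ) : ℂ) • 1 := by
  have : CompleteSpace W := FiniteDimensional.complete ℂ W
  obtain ⟨p, ⟨hR, hs, hσ⟩, hS⟩ := shiftedPower_eq_dunfordIntegral α b hB.exists_isDunfordContour
  have hfd : DifferentiableOn ℂ (fun z : ℂ => z ^ (α : ℂ) + b) (Metric.closedBall p.1 p.2) := by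
    intro z hz
    have h1 : DifferentiableAt ℂ (fun z : ℂ => z ^ (α : ℂ)) z :=
      DifferentiableAt.cpow_const (by fun_prop) (hs hz)
    exact (h1.add_const _).differentiableWithinAt
  have hne : ∀ z ∈ Complex.slitPlane, z ^ (α : ℂ) + b ≠ 0 := by
    intro z hz
    have hz0 := Complex.slitPlane_ne_zero hz
    rw [Complex.cpow_def_of_ne_zero hz0]
    refine exp_add_ofReal_ne_zero ?_ hb
    have h1 : |(Complex.log z).im| < Real.pi := by
      rw [Complex.log_im, abs_lt]
      exact ⟨Complex.neg_pi_lt_arg _, lt_of_le_of_ne (Complex.arg_le_pi _)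
        (Complex.mem_slitPlane_iff_arg.1 hz).1⟩
    rw [Complex.im_mul_ofReal, abs_mul, abs_of_pos hα0]
    nlinarith [abs_nonneg (Complex.log z).im]
  obtain ⟨γ, hγ0, hγ1, hγ⟩ := exists_abs_arg_le (isCompact_closedBall p.1 p.2) hs
  have hsin : 0 < Real.sin γ := Real.sin_pos_of_pos_of_lt_pi hγ0 (by linarith [Real.pi_pos])
  have hterm : ∀ s : ℝ, (quadDenom α b s)⁻¹ • Ring.inverse (resolventFactor α s B) *
      shiftedPower α b B = (quadDenom α b s)⁻¹ • dunfordIntegral B p.1 p.2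
        (fun z => (1 + (Real.exp (-s / α) : ℝ) * z)⁻¹ * (z ^ (α : ℂ) + b)) := by
    intro s
    have h1 := one_add_smul_mul_dunfordIntegral hR.le hσ hfd (e := (Real.exp (-s / α) : ℝ))
      fun z hz => norm_pos_iff.1 (hsin.trans_le
        (sin_le_norm_one_add_mul (Real.exp_pos _).le hγ0.le (hγ z hz)))
    rw [hS, ← h1, smul_mul_assoc, ← mul_assoc]
    change _ • ((Ring.inverse (resolventFactor α s B) * resolventFactor α s B) * _) = _
    rw [Ring.inverse_mul_cancel _ (hB.isUnit_resolventFactor α s), one_mul]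
  rw [← integral_mul_const_of_integrable (hB.integrable_smul_inverse hα0 hα1 hb)]
  simp only [hterm]
  rw [integral_smul_dunfordIntegral (e := fun s => Real.exp (-s / α)) hR.le hσ
    (hfd.continuousOn.mono Metric.sphere_subset_closedBall) hs
    (integrable_inv_quadDenom_ofReal hα0 hα1 hb) (continuous_inv_quadDenom_ofReal hα0 hα1 hb)
    (fun s => (Real.exp_pos _).le) (by fun_prop)]
  have h2 : dunfordIntegral B p.1 p.2 (fun z =>
      (∫ s : ℝ, (quadDenom α b s)⁻¹ * (1 + (Real.exp (-s / α) : ℝ) * z)⁻¹) * (z ^ (α : ℂ) + b)) =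
      dunfordIntegral B p.1 p.2
        (fun z => ((α * Real.pi / Real.sin (Real.pi * α) : ℝ) : ℂ) * (fun _ => 1) z) := by
    refine dunfordIntegral_congr hR.le fun z hz => ?_
    have hz' := hs (Metric.sphere_subset_closedBall hz)
    have h3 := integral_quadrature_scalar hα0 hα1 hb hz'
    simp only [← inv_quadDenom_ofReal] at h3
    simp only
    rw [h3, mul_one, mul_assoc, inv_mul_cancel₀ (hne z hz'), mul_one]
  rw [h2, dunfordIntegral_const_mul, dunfordIntegral_one hR hσ]

/-- The preceding identity provides a left inverse up to a nonzero scalar, which is enough in finite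
dimension. -/
theorem isUnit_shiftedPower (hB : IsSectorial β c₀ B) (hα0 : 0 < α) (hα1 : α < 1) (hb : 0 < b) :
    IsUnit (shiftedPower α b B) := by
  have : CompleteSpace W := FiniteDimensional.complete ℂ W
  have hsin : 0 < Real.sin (Real.pi * α) :=
    Real.sin_pos_of_pos_of_lt_pi (by positivity) (by nlinarith [Real.pi_pos])
  have h := hB.integral_smul_inverse_mul_shiftedPower hα0 hα1 hb
  have hc : ((α * Real.pi / Real.sin (Real.pi * α) : ℝ) : ℂ) ≠ 0 := by
    exact_mod_cast (by positivity : α * Real.pi / Real.sin (Real.pi * α) ≠ 0)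
  have hinj : Function.Injective (shiftedPower α b B) := by
    refine (injective_iff_map_eq_zero _).2 fun v hv => ?_
    have h1 := congrArg (fun S : W →L[ℂ] W => S v) h
    simp only [mul_apply_eq_comp, hv, map_zero, smul_apply,
      one_apply_eq_self] at h1
    exact (smul_eq_zero.1 h1.symm).resolve_left hc
  rw [ContinuousLinearMap.isUnit_iff_bijective]
  exact ⟨hinj, (LinearMap.injective_iff_surjective
    (f := (shiftedPower α b B : W →ₗ[ℂ] W))).1 hinj⟩

/-- The integral representation of the semidiscrete solution. -/
theorem semidiscreteSol_eq (hB : IsSectorial β c₀ B) (hα0 : 0 < α) (hα1 : α < 1) (hb : 0 < b)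
    (f : W) :
    semidiscreteSol α b B f = ((Real.sin (Real.pi * α) / (α * Real.pi) : ℝ) : ℂ) •
      ∫ s : ℝ, quadIntegrand α b B f s := by
  have : CompleteSpace W := FiniteDimensional.complete ℂ W
  have hsin : 0 < Real.sin (Real.pi * α) :=
    Real.sin_pos_of_pos_of_lt_pi (by positivity) (by nlinarith [Real.pi_pos])
  have h := congrArg (fun S : W →L[ℂ] W => S (semidiscreteSol α b B f))
    (hB.integral_smul_inverse_mul_shiftedPower hα0 hα1 hb)
  have h1 : shiftedPower α b B (semidiscreteSol α b B f) = f := by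
    have := congrArg (fun S : W →L[ℂ] W => S f)
      (Ring.mul_inverse_cancel _ (hB.isUnit_shiftedPower hα0 hα1 hb))
    simpa [semidiscreteSol] using this
  simp only [mul_apply_eq_comp, h1, smul_apply,
    one_apply_eq_self] at h
  rw [ContinuousLinearMap.integral_apply (hB.integrable_smul_inverse hα0 hα1 hb)] at h
  simp only [quadIntegrand_eq]
  simp only [smul_apply] at h
  rw [h, smul_smul, ← Complex.ofReal_mul]
  have : Real.sin (Real.pi * α) / (α * Real.pi) * (α * Real.pi / Real.sin (Real.pi * α)) = 1 := by
    have := Real.pi_pos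
    field_simp
  rw [this, Complex.ofReal_one, one_smul]

end IsSectorial

end SectorialOperator

/-! ## The error of the sinc quadrature -/

theorem quadFactor_case_lt {α β τ : ℝ} (h : kappa2 α < kappa1 α β) :
    quadFactor α β τ =
      (Real.sin (min ((kappa1 α β - kappa2 α) / α + (1 - α) / α * τ) (Real.pi / 2)))⁻¹ *
        (1 + |Real.log τ|) := if_pos h

theorem quadFactor_case_ge {α β τ : ℝ} (h : kappa1 α β ≤ kappa2 α) :
    quadFactor α β τ = (Real.sin (min τ (Real.pi / 2)))⁻¹ *
        (1 + |Real.log (kappa2 α - kappa1 α β + α * τ)|) := if_neg h.not_gt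

/-- By `sin u ≤ 2 sin(u/2)`, halving the angle costs at most a factor 2; thus strips retracted by
half steps give the stated `C(τ)`. -/
theorem inv_sin_min_le {x y : ℝ} (hx : 0 < x) (hxy : x / 2 ≤ y) :
    (Real.sin (min y (Real.pi / 2)))⁻¹ ≤ 2 * (Real.sin (min x (Real.pi / 2)))⁻¹ := by
  have hpi := Real.pi_pos
  set u := min x (Real.pi / 2) with hu
  have hu0 : 0 < u := lt_min hx (by positivity)
  have hu1 : u ≤ Real.pi / 2 := min_le_right _ _
  have h1 : u / 2 ≤ min y (Real.pi / 2) :=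
    le_min (by linarith [min_le_left x (Real.pi / 2)]) (by linarith)
  have h2 : Real.sin (u / 2) ≤ Real.sin (min y (Real.pi / 2)) :=
    Real.sin_le_sin_of_le_of_le_pi_div_two (by linarith) (min_le_right _ _) h1
  have h3 : 0 < Real.sin (u / 2) := Real.sin_pos_of_pos_of_lt_pi (by linarith) (by linarith)
  have h4 : Real.sin u ≤ 2 * Real.sin (u / 2) := by
    have e : u = 2 * (u / 2) := by ring
    nth_rewrite 1 [e]
    rw [Real.sin_two_mul]
    nlinarith [Real.cos_le_one (u / 2)]
  have h5 : 0 < Real.sin u := Real.sin_pos_of_pos_of_lt_pi hu0 (by linarith)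
  calc _ ≤ (Real.sin u / 2)⁻¹ := by
        apply inv_anti₀ (by positivity); linarith
    _ = _ := by rw [inv_div, div_eq_mul_inv]

theorem inv_sin_min_nonneg {x : ℝ} (hx : 0 ≤ x) : 0 ≤ (Real.sin (min x (Real.pi / 2)))⁻¹ := by
  have hpi := Real.pi_pos
  refine inv_nonneg.2 (Real.sin_nonneg_of_nonneg_of_le_pi (le_min hx (by positivity)) ?_)
  linarith [min_le_right x (Real.pi / 2)]

/-- Retracting the strip by `Mτ/2` multiplies the exponential by `e^{πM} ≤ e^π`, and `d ≥ mτ/2`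
keeps `1 - q` at least `1 - e^{-πm}`. -/
theorem exp_div_one_sub_le {d τ m M κ : ℝ} (hτ : 0 < τ) (hm : 0 < m) (hM : M ≤ 1)
    (h1 : m * τ / 2 ≤ d) (h2 : d = κ - M * τ / 2) :
    Real.exp (-2 * Real.pi * d / τ) / (1 - Real.exp (-2 * Real.pi * d / τ)) ≤
      Real.exp Real.pi / (1 - Real.exp (-(Real.pi * m))) * Real.exp (-2 * Real.pi * κ / τ) := by
  have hpi := Real.pi_pos
  have e1 : Real.exp (-2 * Real.pi * d / τ) ≤ Real.exp (-(Real.pi * m)) := by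
    refine Real.exp_le_exp.2 ?_
    rw [div_le_iff₀ hτ]
    nlinarith
  have e2 : Real.exp (-(Real.pi * m)) < 1 := by
    rw [Real.exp_lt_one_iff]; nlinarith
  have e3 : Real.exp (-2 * Real.pi * d / τ) ≤ Real.exp Real.pi * Real.exp (-2 * Real.pi * κ / τ) := by
    rw [← Real.exp_add]
    refine Real.exp_le_exp.2 ?_
    have : -2 * Real.pi * d / τ = -2 * Real.pi * κ / τ + Real.pi * M := by
      rw [h2]; field_simp; ring
    rw [this]
    nlinarith
  have e4 : 0 < 1 - Real.exp (-(Real.pi * m)) := by linarith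
  rw [div_mul_eq_mul_div]
  gcongr

/-- Here the zeros of the scalar denominator limit the strip. With `d = κ₂ - (1-α)τ/2` the logarithm
is taken at `(1-α)τ/(4π)`, and the resolvent angle is at least half the one in `C(τ)`. -/
theorem inv_sin_mul_log_le_of_lt {α β τ L : ℝ} (hα0 : 0 < α) (hα1 : α < 1) (hτ : 0 < τ)
    (hlt : kappa2 α < kappa1 α β) (hLpos : 1 ≤ L)
    (hL1 : |Real.log ((1 - α) / (4 * Real.pi))| ≤ L - 1) :
    (Real.sin (min ((kappa1 α β - (kappa2 α - (1 - α) * τ / 2)) / α) (Real.pi / 2)))⁻¹ *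
      |Real.log ((kappa2 α - (kappa2 α - (1 - α) * τ / 2)) / (2 * Real.pi))| ≤
      2 * L * quadFactor α β τ := by
  have hpi := Real.pi_pos
  rw [quadFactor_case_lt hlt]
  have h1 : kappa2 α - (kappa2 α - (1 - α) * τ / 2) = (1 - α) * τ / 2 := by ring
  have hX : 0 < (kappa1 α β - kappa2 α) / α + (1 - α) / α * τ := by
    have : 0 < (kappa1 α β - kappa2 α) / α := div_pos (by linarith) hα0
    have : 0 < (1 - α) / α * τ := mul_pos (div_pos (by linarith) hα0) hτ
    linarith
  have h2 := inv_sin_min_le (y := (kappa1 α β - (kappa2 α - (1 - α) * τ / 2)) / α) hX (by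
    have : 0 < (kappa1 α β - kappa2 α) / α := div_pos (by linarith) hα0
    have e : (kappa1 α β - (kappa2 α - (1 - α) * τ / 2)) / α =
      (kappa1 α β - kappa2 α) / α + (1 - α) / α * τ / 2 := by field_simp; ring
    rw [e]; linarith)
  have h3 : |Real.log ((kappa2 α - (kappa2 α - (1 - α) * τ / 2)) / (2 * Real.pi))| ≤
      L * (1 + |Real.log τ|) := by
    have e : (1 - α) * τ / 2 / (2 * Real.pi) = τ * ((1 - α) / (4 * Real.pi)) := by
      field_simp; ring
    have h4 : (1 - α) / (4 * Real.pi) ≠ 0 := (div_pos (by linarith) (by positivity)).ne'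
    rw [h1, e, Real.log_mul hτ.ne' h4]
    refine (abs_add_le _ _).trans ?_
    nlinarith [abs_nonneg (Real.log τ)]
  have h5 : 0 ≤ (Real.sin (min ((kappa1 α β - kappa2 α) / α + (1 - α) / α * τ)
      (Real.pi / 2)))⁻¹ := inv_sin_min_nonneg hX.le
  refine (mul_le_mul h2 h3 (abs_nonneg _) (by positivity)).trans (le_of_eq ?_)
  ring

/-- Here the resolvent limits the strip. With `d = κ₁ - ατ/2` the remaining angle is `τ/2`, and the
argument of the logarithm lies between `E/(4π)` and `E`, where `E = κ₂ - κ₁ + ατ`. -/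
theorem inv_sin_mul_log_le_of_ge {α β τ L : ℝ} (hα0 : 0 < α) (hτ : 0 < τ)
    (hge : kappa1 α β ≤ kappa2 α) (hLpos : 1 ≤ L) (hL2 : |Real.log (4 * Real.pi)| ≤ L - 1) :
    (Real.sin (min ((kappa1 α β - (kappa1 α β - α * τ / 2)) / α) (Real.pi / 2)))⁻¹ *
      |Real.log ((kappa2 α - (kappa1 α β - α * τ / 2)) / (2 * Real.pi))| ≤
      2 * L * quadFactor α β τ := by
  have hpi := Real.pi_pos
  rw [quadFactor_case_ge hge]
  set E := kappa2 α - kappa1 α β + α * τ with hE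
  have hατ : 0 < α * τ := by positivity
  have hE0 : 0 < E := by linarith
  have h2 := inv_sin_min_le (y := (kappa1 α β - (kappa1 α β - α * τ / 2)) / α) hτ (by
    have e : (kappa1 α β - (kappa1 α β - α * τ / 2)) / α = τ / 2 := by field_simp; ring
    rw [e])
  set δ := (kappa2 α - (kappa1 α β - α * τ / 2)) / (2 * Real.pi) with hδ
  have hδ1 : E / (4 * Real.pi) ≤ δ := by
    rw [hδ, div_le_div_iff₀ (by positivity) (by positivity)]
    nlinarith
  have hδ2 : δ ≤ E := by
    rw [hδ, div_le_iff₀ (by positivity)]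
    nlinarith [Real.pi_gt_three]
  have hδ0 : 0 < δ := lt_of_lt_of_le (by positivity) hδ1
  have h3 : |Real.log δ| ≤ L * (1 + |Real.log E|) := by
    have h4 := Real.log_le_log (by positivity) hδ1
    have h5 := Real.log_le_log hδ0 hδ2
    rw [Real.log_div hE0.ne' (by positivity)] at h4
    have h6 : |Real.log δ| ≤ |Real.log E| + |Real.log (4 * Real.pi)| := by
      rw [abs_le]
      constructor
      · linarith [neg_abs_le (Real.log E), le_abs_self (Real.log (4 * Real.pi))]
      · linarith [le_abs_self (Real.log E), abs_nonneg (Real.log (4 * Real.pi))]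
    nlinarith [abs_nonneg (Real.log E)]
  have h5 : 0 ≤ (Real.sin (min τ (Real.pi / 2)))⁻¹ := inv_sin_min_nonneg hτ.le
  refine (mul_le_mul h2 h3 (abs_nonneg _) (by positivity)).trans (le_of_eq ?_)
  ring

namespace IsSectorial

variable {W : Type*} [NormedAddCommGroup W] [InnerProductSpace ℂ W] [FiniteDimensional ℂ W]
variable {β c₀ α b : ℝ} {B : W →L[ℂ] W}

theorem norm_quadIntegrand_le (hB : IsSectorial β c₀ B) (hα0 : 0 < α) (hα1 : α < 1) (hb : 0 < b)
    (f : W) : ∃ C, ∀ s, ‖quadIntegrand α b B f s‖ ≤ C * (1 + s ^ 2)⁻¹ := by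
  have hk : 0 < kappa2 α := mul_pos (by linarith) Real.pi_pos
  obtain ⟨h1, h2⟩ := delta_mem hα0 le_rfl hk
  set δ := (kappa2 α - 0) / (2 * Real.pi)
  have hm0 : 0 < min α (1 - α) := lt_min hα0 (by linarith)
  refine ⟨2 / (b * min α (1 - α)) * (δ⁻¹ * (2 * (1 + Real.log b ^ 2))) * ‖f‖, fun s => ?_⟩
  rw [quadIntegrand_eq, norm_smul]
  have h3 := norm_inv_quadDenom_le hα0 hα1 hb hk (z := s) (by simp)
  have h4 := hB.norm_inverse_resolventFactor_le α s f
  have h5 := poleKernel_sub_le h1 (by linarith) (Real.log b) s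
  rw [Complex.ofReal_re] at h3
  calc _ ≤ (2 / (b * min α (1 - α)) * (δ⁻¹ * (2 * (1 + Real.log b ^ 2)) * (1 + s ^ 2)⁻¹)) * ‖f‖ := by
        refine mul_le_mul (h3.trans ?_) h4 (norm_nonneg _) (by positivity)
        gcongr
    _ = _ := by ring

theorem summable_quadIntegrand (hB : IsSectorial β c₀ B) (hα0 : 0 < α) (hα1 : α < 1) (hb : 0 < b)
    (f : W) {τ : ℝ} (hτ : 0 < τ) : Summable fun n : ℤ => quadIntegrand α b B f (n * τ) := by
  have : CompleteSpace W := FiniteDimensional.complete ℂ W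
  obtain ⟨C, hC⟩ := hB.norm_quadIntegrand_le hα0 hα1 hb f
  exact summable_int_mul_of_le_inv hτ hC

theorem integrable_quadIntegrand (hB : IsSectorial β c₀ B) (hα0 : 0 < α) (hα1 : α < 1)
    (hb : 0 < b) (f : W) : Integrable (quadIntegrand α b B f) := by
  have h := (hB.integrable_smul_inverse hα0 hα1 hb).apply_continuousLinearMap f
  refine h.congr (Eventually.of_forall fun s => ?_)
  simp only [quadIntegrand_eq, smul_apply]

/-- The error of the quadrature in terms of the half-width `d` of a strip of holomorphy. -/
theorem norm_error_le (hB : IsSectorial β c₀ B) (hα0 : 0 < α) (hα1 : α < 1) (hb : 0 < b) (f : W)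
    {τ d γ : ℝ} (hτ : 0 < τ) (hd0 : 0 < d) (hdk : d < kappa2 α) (hγ0 : 0 < γ)
    (hγ1 : γ ≤ Real.pi / 2) (hdγ : d / α + Real.arctan β ≤ Real.pi - γ) :
    ‖semidiscreteSol α b B f - quadSol α b τ B f‖ ≤
      Real.sin (Real.pi * α) / (α * Real.pi) *
        (2 * (Real.exp (-2 * Real.pi * d / τ) / (1 - Real.exp (-2 * Real.pi * d / τ))) *
          ((Real.sin γ)⁻¹ * ‖f‖ * (2 / (b * min α (1 - α))) *
            (4 * |Real.log ((kappa2 α - d) / (2 * Real.pi))|))) := by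
  have : CompleteSpace W := FiniteDimensional.complete ℂ W
  have hpi := Real.pi_pos
  have hsinα : 0 < Real.sin (Real.pi * α) :=
    Real.sin_pos_of_pos_of_lt_pi (by positivity) (by nlinarith)
  have hsinγ : 0 < Real.sin γ := Real.sin_pos_of_pos_of_lt_pi hγ0 (by linarith)
  have hm0 : 0 < min α (1 - α) := lt_min hα0 (by linarith)
  obtain ⟨hδ0, hδ1⟩ := delta_mem hα0 hd0.le hdk
  set δ := (kappa2 α - d) / (2 * Real.pi) with hδ
  set err := semidiscreteSol α b B f - quadSol α b τ B f with herr
  set c := Real.sin (Real.pi * α) / (α * Real.pi) with hc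
  have hc0 : 0 < c := by positivity
  set M := (Real.sin γ)⁻¹ * ‖f‖ * (2 / (b * min α (1 - α))) with hM
  -- Testing with the error vector itself reduces the problem to a scalar trapezoidal rule: `‖err‖²`
  -- is then bounded by `‖err‖` times the desired quantity. The fixed vector sits in the antilinear
  -- slot, so `g` is holomorphic.
  set g : ℂ → ℂ := fun z => (quadDenom α b z)⁻¹ *
    inner ℂ err (Ring.inverse (1 + Complex.exp (-(z / α)) • B) f) with hg
  set k : ℝ → ℝ := fun x => ‖err‖ * M * poleKernel δ (x - Real.log b) with hk
  have hang : ∀ z : ℂ, z.im ∈ Set.Icc (-d) d →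
      |(z / α).im| + Real.arctan β ≤ Real.pi - γ := by
    intro z hz
    rw [Complex.div_ofReal_im, abs_div, abs_of_pos hα0]
    have : |z.im| / α ≤ d / α := by gcongr; exact abs_le.2 hz
    linarith
  have hgd : DifferentiableOn ℂ g {z | z.im ∈ Set.Icc (-d) d} := by
    intro z hz
    have hu := hB.isUnit_one_add hγ0 hγ1 (hang z hz)
    have h1 : DifferentiableAt ℂ (quadDenom α b) z := by unfold quadDenom; fun_prop
    have h2 := h1.inv (quadDenom_ne_zero hα0 hα1 hb hdk (abs_le.2 hz))
    have h3 : DifferentiableAt ℂ (fun z : ℂ => (1 : W →L[ℂ] W) + Complex.exp (-(z / α)) • B) z := by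
      fun_prop
    have h4 : DifferentiableAt ℂ
        (fun z : ℂ => Ring.inverse ((1 : W →L[ℂ] W) + Complex.exp (-(z / α)) • B)) z :=
      DifferentiableAt.comp z (g := Ring.inverse) (differentiableAt_inverse hu) h3
    have h5 : DifferentiableAt ℂ (fun z : ℂ =>
        Ring.inverse ((1 : W →L[ℂ] W) + Complex.exp (-(z / α)) • B) f) z :=
      h4.clm_apply (differentiableAt_const f)
    have h6 : DifferentiableAt ℂ (fun z : ℂ => (innerSL ℂ err)
        (Ring.inverse ((1 : W →L[ℂ] W) + Complex.exp (-(z / α)) • B) f)) z :=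
      (innerSL ℂ err).differentiableAt.comp z h5
    exact (h2.mul h6).differentiableWithinAt
  have hgb : ∀ z : ℂ, z.im ∈ Set.Icc (-d) d → ‖g z‖ ≤ k z.re := by
    intro z hz
    have h1 := norm_inv_quadDenom_le hα0 hα1 hb hdk (abs_le.2 hz)
    have h2 := hB.norm_inverse_le hγ0 hγ1 (hang z hz) f
    have h3 := norm_inner_le_norm (𝕜 := ℂ) err (Ring.inverse (1 + Complex.exp (-(z / α)) • B) f)
    have hp := poleKernel_nonneg hδ0 (z.re - Real.log b)
    rw [hg]
    simp only [norm_mul]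
    calc _ ≤ (2 / (b * min α (1 - α)) * poleKernel δ (z.re - Real.log b)) *
          (‖err‖ * ((Real.sin γ)⁻¹ * ‖f‖)) := by
          refine mul_le_mul h1 (h3.trans ?_) (norm_nonneg _) (by positivity)
          gcongr
      _ = _ := by rw [hk, hM]; ring
  have hM0 : 0 ≤ M := by positivity
  have hkint : Integrable k :=
    ((integrable_poleKernel hδ0 (by linarith)).comp_sub_right (Real.log b)).const_mul _
  have hkC : ∀ x, k x ≤ ‖err‖ * M * (δ⁻¹ * (2 * (1 + Real.log b ^ 2))) * (1 + x ^ 2)⁻¹ := by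
    intro x
    rw [mul_assoc (‖err‖ * M)]
    exact mul_le_mul_of_nonneg_left (poleKernel_sub_le hδ0 (by linarith) _ _) (by positivity)
  have hkval : ∫ x, k x ≤ ‖err‖ * M * (4 * |Real.log δ|) := by
    rw [hk, integral_const_mul, integral_sub_right_eq_self (poleKernel δ) (Real.log b)]
    exact mul_le_mul_of_nonneg_left (integral_poleKernel_le hδ0 hδ1) (by positivity)
  have htrap := norm_integral_sub_trapezoid_le hd0 hτ hgd hkint hkC hgb
  have hgq : ∀ s : ℝ, g s = innerSL ℂ err (quadIntegrand α b B f s) := by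
    intro s
    have h1 : -((s : ℂ) / α) = -((s / α : ℝ) : ℂ) := by push_cast; rfl
    rw [quadIntegrand_eq, resolventFactor_eq, map_smul, smul_eq_mul, ← h1]
    rfl
  have hE : inner ℂ err err = (c : ℂ) * ((∫ x : ℝ, g x) - τ * ∑' n : ℤ, g ((n * τ : ℝ) : ℂ)) := by
    have h1 : (∫ x : ℝ, g x) = innerSL ℂ err (∫ s, quadIntegrand α b B f s) := by
      simp only [hgq]
      exact ContinuousLinearMap.integral_comp_comm _ (hB.integrable_quadIntegrand hα0 hα1 hb f)
    have h2 : ∑' n : ℤ, g ((n * τ : ℝ) : ℂ) =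
        innerSL ℂ err (∑' n : ℤ, quadIntegrand α b B f (n * τ)) := by
      simp only [hgq]
      exact (ContinuousLinearMap.map_tsum _ (hB.summable_quadIntegrand hα0 hα1 hb f hτ)).symm
    have h3 : err = (c : ℂ) • ((∫ s, quadIntegrand α b B f s) -
        (τ : ℂ) • ∑' n : ℤ, quadIntegrand α b B f (n * τ)) := by
      rw [herr, hB.semidiscreteSol_eq hα0 hα1 hb, quadSol, smul_sub, smul_smul, Complex.ofReal_mul]
    have h4 : inner ℂ err err = innerSL ℂ err err := rfl
    rw [h4]
    nth_rewrite 2 [h3]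
    rw [map_smul, map_sub, map_smul, h1, h2]
    rfl
  have hsq : ‖err‖ * ‖err‖ = c * ‖(∫ x : ℝ, g x) - τ * ∑' n : ℤ, g ((n * τ : ℝ) : ℂ)‖ := by
    have := congrArg norm hE
    rw [norm_mul, Complex.norm_real, Real.norm_of_nonneg hc0.le, inner_self_eq_norm_sq_to_K] at this
    rw [← this]
    simp [sq]
  set q := Real.exp (-2 * Real.pi * d / τ) with hq
  have hq1 : q < 1 := by
    rw [hq, Real.exp_lt_one_iff]
    have : 0 < 2 * Real.pi * d / τ := by positivity
    have e : -2 * Real.pi * d / τ = -(2 * Real.pi * d / τ) := by ring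
    linarith
  have hq2 : 0 ≤ q / (1 - q) := div_nonneg (Real.exp_pos _).le (by linarith)
  rcases (norm_nonneg err).eq_or_lt with h0 | h0
  · rw [← h0]; positivity
  · refine le_of_mul_le_mul_left ?_ h0
    rw [hsq]
    calc _ ≤ c * (2 * (q / (1 - q)) * (‖err‖ * M * (4 * |Real.log δ|))) := by
          gcongr
          exact htrap.trans (by gcongr)
      _ = _ := by ring

/-- The error estimate, with a constant that depends only on `α`. -/
theorem norm_error_le_quadFactor (hα0 : 0 < α) (hα1 : α < 1) : ∃ C : ℝ, 0 < C ∧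
    ∀ {W : Type*} [NormedAddCommGroup W] [InnerProductSpace ℂ W] [FiniteDimensional ℂ W]
      {β c₀ b : ℝ} {B : W →L[ℂ] W}, IsSectorial β c₀ B → 0 < b → ∀ (f : W) {τ : ℝ}, 0 < τ →
      τ < Real.pi - Real.arctan β →
      ‖semidiscreteSol α b B f - quadSol α b τ B f‖ ≤
        C / b * quadFactor α β τ *
          Real.exp (-2 * Real.pi * min (kappa1 α β) (kappa2 α) / τ) * ‖f‖ := by
  have hpi := Real.pi_pos
  set m := min α (1 - α) with hm
  have hm0 : 0 < m := lt_min hα0 (by linarith)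
  have hmα : m ≤ α := min_le_left _ _
  have hmα' : m ≤ 1 - α := min_le_right _ _
  have hsinα : 0 < Real.sin (Real.pi * α) :=
    Real.sin_pos_of_pos_of_lt_pi (by positivity) (by nlinarith)
  have hem : 0 < 1 - Real.exp (-(Real.pi * m)) := by
    have : Real.exp (-(Real.pi * m)) < 1 := by rw [Real.exp_lt_one_iff]; nlinarith
    linarith
  set K := Real.sin (Real.pi * α) / (α * Real.pi) *
    (2 * (Real.exp Real.pi / (1 - Real.exp (-(Real.pi * m)))) * (2 / m * 4)) with hK
  have hK0 : 0 < K := by positivity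
  -- Large enough to absorb the additive constants from the logarithms of both cases.
  set L := 1 + |Real.log ((1 - α) / (4 * Real.pi))| + |Real.log (4 * Real.pi)| with hL
  have hL1 : |Real.log ((1 - α) / (4 * Real.pi))| ≤ L - 1 := by
    have := abs_nonneg (Real.log (4 * Real.pi)); linarith
  have hL2 : |Real.log (4 * Real.pi)| ≤ L - 1 := by
    have := abs_nonneg (Real.log ((1 - α) / (4 * Real.pi))); linarith
  have hLpos : 1 ≤ L := by
    have := abs_nonneg (Real.log (4 * Real.pi)); linarith
  refine ⟨K * (2 * L), by positivity, ?_⟩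
  intro W _ _ _ β c₀ b B hB hb f τ hτ hτβ
  have hβ0 : 0 ≤ Real.arctan β := Real.arctan_nonneg.2 hB.nonneg
  have hk1 : kappa1 α β = α * (Real.pi - Real.arctan β) := rfl
  have hk2 : kappa2 α = (1 - α) * Real.pi := rfl
  have main : ∀ d M : ℝ, M ≤ 1 → m * τ / 2 ≤ d → d = min (kappa1 α β) (kappa2 α) - M * τ / 2 →
      d < kappa2 α → d < kappa1 α β →
      (Real.sin (min ((kappa1 α β - d) / α) (Real.pi / 2)))⁻¹ *
        |Real.log ((kappa2 α - d) / (2 * Real.pi))| ≤ 2 * L * quadFactor α β τ →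
      ‖semidiscreteSol α b B f - quadSol α b τ B f‖ ≤
        K * (2 * L) / b * quadFactor α β τ *
          Real.exp (-2 * Real.pi * min (kappa1 α β) (kappa2 α) / τ) * ‖f‖ := by
    intro d M hM hdm hd hdk2 hdk1 hfac
    have hd0 : 0 < d := lt_of_lt_of_le (by positivity) hdm
    set γ := min ((kappa1 α β - d) / α) (Real.pi / 2) with hγ
    have hγ0 : 0 < γ := lt_min (div_pos (by linarith) hα0) (by positivity)
    have hγ1 : γ ≤ Real.pi / 2 := min_le_right _ _
    have hdγ : d / α + Real.arctan β ≤ Real.pi - γ := by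
      have h1 : γ ≤ (kappa1 α β - d) / α := min_le_left _ _
      have h2 : (kappa1 α β - d) / α = Real.pi - Real.arctan β - d / α := by
        rw [hk1]; field_simp
      linarith
    have hsinγ : 0 < Real.sin γ := Real.sin_pos_of_pos_of_lt_pi hγ0 (by linarith)
    refine (hB.norm_error_le hα0 hα1 hb f hτ hd0 hdk2 hγ0 hγ1 hdγ).trans ?_
    have hexp := exp_div_one_sub_le hτ hm0 hM hdm hd
    set X := Real.exp (-2 * Real.pi * min (kappa1 α β) (kappa2 α) / τ)
    calc _ ≤ Real.sin (Real.pi * α) / (α * Real.pi) *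
        (2 * (Real.exp Real.pi / (1 - Real.exp (-(Real.pi * m))) * X) *
          ((Real.sin γ)⁻¹ * ‖f‖ * (2 / (b * min α (1 - α))) *
            (4 * |Real.log ((kappa2 α - d) / (2 * Real.pi))|))) := by gcongr
      _ = K / b * ((Real.sin γ)⁻¹ * |Real.log ((kappa2 α - d) / (2 * Real.pi))|) * X * ‖f‖ := by
          rw [hK, ← hm]; field_simp
      _ ≤ K / b * (2 * L * quadFactor α β τ) * X * ‖f‖ := by gcongr
      _ = _ := by ring
  -- In both cases `d ≥ mτ/2` rests on `τ < π - arctan β`, which in particular gives `τ < π`.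
  rcases lt_or_ge (kappa2 α) (kappa1 α β) with hlt | hge
  · refine main (kappa2 α - (1 - α) * τ / 2) (1 - α) (by linarith) ?_ (by rw [min_eq_right hlt.le])
      (by nlinarith) (by nlinarith) ?_
    · rw [hk2]; nlinarith
    · exact inv_sin_mul_log_le_of_lt hα0 hα1 hτ hlt hLpos hL1
  · refine main (kappa1 α β - α * τ / 2) α hα1.le ?_ (by rw [min_eq_left hge])
      (by nlinarith) (by nlinarith) ?_
    · rw [hk1]; nlinarith
    · exact inv_sin_mul_log_le_of_ge hα0 hτ hge hLpos hL2

end IsSectorial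

/-! ## The sesquilinear form and its discrete operator -/

section WeakGradient

variable {d : ℕ} {Ω : Set (Eucl d)}

theorem integrable_smul_L2 (hb : Bornology.IsBounded Ω) {φ : Eucl d → ℝ} (hφ : Continuous φ)
    (hc : HasCompactSupport φ) (v : L2C Ω) :
    Integrable (fun x => φ x • v x) (volume.restrict Ω) := by
  have : IsFiniteMeasure (volume.restrict Ω) := ⟨by
    rw [Measure.restrict_apply_univ]; exact hb.measure_lt_top⟩
  have hv : Integrable v (volume.restrict Ω) := (Lp.memLp v).integrable one_le_two
  obtain ⟨C, hC⟩ := hc.exists_bound_of_continuous hφ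
  exact hv.bdd_smul C hφ.aestronglyMeasurable (Eventually.of_forall hC)

theorem continuous_partialDeriv {φ : Eucl d → ℝ} (hφ : ContDiff ℝ ∞ φ) (i : Fin d) :
    Continuous (partialDeriv i φ) :=
  (hφ.continuous_fderiv (by simp)).clm_apply continuous_const

theorem hasCompactSupport_partialDeriv {φ : Eucl d → ℝ} (hc : HasCompactSupport φ) (i : Fin d) :
    HasCompactSupport (partialDeriv i φ) :=
  hc.fderiv_apply (𝕜 := ℝ) _

theorem isWeakGrad_weakGrad {v : L2C Ω} (h : MemH1 Ω v) : IsWeakGrad Ω v (weakGrad Ω v) := by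
  rw [weakGrad, dif_pos h]
  exact h.choose_spec

/-- The fundamental lemma of the calculus of variations; boundedness of `Ω` makes `L²` functions
integrable. -/
theorem IsWeakGrad.unique (ho : IsOpen Ω) (hb : Bornology.IsBounded Ω) {v : L2C Ω}
    {g g' : Fin d → L2C Ω} (hg : IsWeakGrad Ω v g) (hg' : IsWeakGrad Ω v g') (i : Fin d) :
    g i = g' i := by
  have : IsFiniteMeasure (volume.restrict Ω) := ⟨by
    rw [Measure.restrict_apply_univ]; exact hb.measure_lt_top⟩
  have hint : Integrable (fun x => g i x - g' i x) (volume.restrict Ω) :=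
    ((Lp.memLp (g i)).integrable one_le_two).sub ((Lp.memLp (g' i)).integrable one_le_two)
  have h := ho.ae_eq_zero_of_integral_contDiff_smul_eq_zero (μ := volume.restrict Ω)
    (f := fun x => g i x - g' i x) (hint.locallyIntegrable.locallyIntegrableOn Ω) (by
      intro φ hφ hc hs
      have h1 := hg φ hφ hc hs i
      have h2 := hg' φ hφ hc hs i
      simp only [smul_sub]
      rw [integral_sub (integrable_smul_L2 hb hφ.continuous hc _)
        (integrable_smul_L2 hb hφ.continuous hc _)]
      have h3 := h1.symm.trans h2
      rw [neg_inj] at h3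
      rw [h3, sub_self])
  refine Lp.ext ?_
  filter_upwards [h, ae_restrict_mem ho.measurableSet] with x hx hxΩ
  exact sub_eq_zero.1 (hx hxΩ)

theorem IsWeakGrad.add (hb : Bornology.IsBounded Ω) {v w : L2C Ω} {g h : Fin d → L2C Ω}
    (hg : IsWeakGrad Ω v g) (hh : IsWeakGrad Ω w h) : IsWeakGrad Ω (v + w) (g + h) := by
  intro φ hφ hc hs i
  have hd := continuous_partialDeriv hφ i
  have hdc := hasCompactSupport_partialDeriv hc i
  have e1 : ∫ x in Ω, partialDeriv i φ x • (v + w) x =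
      ∫ x in Ω, (partialDeriv i φ x • v x + partialDeriv i φ x • w x) := by
    refine integral_congr_ae ?_
    filter_upwards [Lp.coeFn_add v w] with x hx
    rw [hx, Pi.add_apply, smul_add]
  have e2 : ∫ x in Ω, φ x • (g + h) i x = ∫ x in Ω, (φ x • g i x + φ x • h i x) := by
    refine integral_congr_ae ?_
    filter_upwards [Lp.coeFn_add (g i) (h i)] with x hx
    rw [Pi.add_apply, hx, Pi.add_apply, smul_add]
  rw [e1, e2, integral_add (integrable_smul_L2 hb hd hdc _) (integrable_smul_L2 hb hd hdc _),
    integral_add (integrable_smul_L2 hb hφ.continuous hc _)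
      (integrable_smul_L2 hb hφ.continuous hc _), hg φ hφ hc hs i, hh φ hφ hc hs i, neg_add]

theorem IsWeakGrad.smul {v : L2C Ω} {g : Fin d → L2C Ω} (hg : IsWeakGrad Ω v g) (c : ℂ) :
    IsWeakGrad Ω (c • v) (c • g) := by
  intro φ hφ hc hs i
  have e1 : ∫ x in Ω, partialDeriv i φ x • (c • v) x = ∫ x in Ω, c • partialDeriv i φ x • v x := by
    refine integral_congr_ae ?_
    filter_upwards [Lp.coeFn_smul c v] with x hx
    rw [hx, Pi.smul_apply, smul_comm]
  have e2 : ∫ x in Ω, φ x • (c • g) i x = ∫ x in Ω, c • φ x • g i x := by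
    refine integral_congr_ae ?_
    filter_upwards [Lp.coeFn_smul c (g i)] with x hx
    rw [Pi.smul_apply, hx, Pi.smul_apply, smul_comm]
  rw [e1, e2, integral_smul, integral_smul, hg φ hφ hc hs i, smul_neg]

/-- `weakGrad` is an arbitrary choice, so its linearity has to be deduced from uniqueness. -/
theorem weakGrad_add (ho : IsOpen Ω) (hb : Bornology.IsBounded Ω) {v w : L2C Ω}
    (hv : MemH1 Ω v) (hw : MemH1 Ω w) (i : Fin d) :
    weakGrad Ω (v + w) i = weakGrad Ω v i + weakGrad Ω w i := by
  have h := (isWeakGrad_weakGrad hv).add hb (isWeakGrad_weakGrad hw)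
  exact (isWeakGrad_weakGrad ⟨_, h⟩).unique ho hb h i

theorem weakGrad_smul (ho : IsOpen Ω) (hb : Bornology.IsBounded Ω) {v : L2C Ω}
    (hv : MemH1 Ω v) (c : ℂ) (i : Fin d) : weakGrad Ω (c • v) i = c • weakGrad Ω v i := by
  have h := (isWeakGrad_weakGrad hv).smul c
  exact (isWeakGrad_weakGrad ⟨_, h⟩).unique ho hb h i

theorem ae_weakGrad_add (ho : IsOpen Ω) (hb : Bornology.IsBounded Ω) {v w : L2C Ω}
    (hv : MemH1 Ω v) (hw : MemH1 Ω w) : ∀ᵐ x ∂volume.restrict Ω, (v + w) x = v x + w x ∧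
      ∀ i, weakGrad Ω (v + w) i x = weakGrad Ω v i x + weakGrad Ω w i x := by
  have h : ∀ᵐ x ∂volume.restrict Ω,
      ∀ i, weakGrad Ω (v + w) i x = weakGrad Ω v i x + weakGrad Ω w i x := by
    rw [ae_all_iff]
    intro i
    rw [weakGrad_add ho hb hv hw]
    exact Lp.coeFn_add _ _
  filter_upwards [h, Lp.coeFn_add v w] with x h1 h2
  exact ⟨h2, h1⟩

theorem ae_weakGrad_smul (ho : IsOpen Ω) (hb : Bornology.IsBounded Ω) {v : L2C Ω}
    (hv : MemH1 Ω v) (c : ℂ) : ∀ᵐ x ∂volume.restrict Ω, (c • v) x = c * v x ∧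
      ∀ i, weakGrad Ω (c • v) i x = c * weakGrad Ω v i x := by
  have h : ∀ᵐ x ∂volume.restrict Ω, ∀ i, weakGrad Ω (c • v) i x = c * weakGrad Ω v i x := by
    rw [ae_all_iff]
    intro i
    rw [weakGrad_smul ho hb hv]
    exact Lp.coeFn_smul _ _
  filter_upwards [h, Lp.coeFn_smul c v] with x h1 h2
  exact ⟨h2, h1⟩

/-! ### Sesquilinearity of the form. -/

variable {Cm : Eucl d → Matrix (Fin d) (Fin d) ℂ} {a : Eucl d → Fin d → ℂ} {r : Eucl d → ℂ}

theorem sesqForm_add_left (ho : IsOpen Ω) (hb : Bornology.IsBounded Ω) {u v w : L2C Ω}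
    (hu : MemH1 Ω u) (hv : MemH1 Ω v) (hiu : IntegrableOn (formIntegrand Ω Cm a r u w) Ω)
    (hiv : IntegrableOn (formIntegrand Ω Cm a r v w) Ω) :
    sesqForm Ω Cm a r (u + v) w = sesqForm Ω Cm a r u w + sesqForm Ω Cm a r v w := by
  rw [sesqForm, sesqForm, sesqForm, ← integral_add hiu hiv]
  refine integral_congr_ae ?_
  filter_upwards [ae_weakGrad_add ho hb hu hv] with x hx
  simp only [formIntegrand, hx.1, hx.2, add_mul, mul_add, Finset.sum_add_distrib]
  ring

theorem sesqForm_add_right (ho : IsOpen Ω) (hb : Bornology.IsBounded Ω) {u v w : L2C Ω}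
    (hu : MemH1 Ω u) (hv : MemH1 Ω v) (hiu : IntegrableOn (formIntegrand Ω Cm a r w u) Ω)
    (hiv : IntegrableOn (formIntegrand Ω Cm a r w v) Ω) :
    sesqForm Ω Cm a r w (u + v) = sesqForm Ω Cm a r w u + sesqForm Ω Cm a r w v := by
  rw [sesqForm, sesqForm, sesqForm, ← integral_add hiu hiv]
  refine integral_congr_ae ?_
  filter_upwards [ae_weakGrad_add ho hb hu hv] with x hx
  simp only [formIntegrand, hx.1, hx.2, star_add, mul_add, Finset.sum_add_distrib]
  ring

theorem sesqForm_smul_left (ho : IsOpen Ω) (hb : Bornology.IsBounded Ω) {v w : L2C Ω}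
    (hv : MemH1 Ω v) (c : ℂ) : sesqForm Ω Cm a r (c • v) w = c * sesqForm Ω Cm a r v w := by
  rw [sesqForm, sesqForm, ← integral_const_mul]
  refine integral_congr_ae ?_
  filter_upwards [ae_weakGrad_smul ho hb hv c] with x hx
  simp only [formIntegrand, hx.1, hx.2, mul_add, Finset.mul_sum, Finset.sum_mul]
  congr 1
  · congr 1
    · exact Finset.sum_congr rfl fun i _ => Finset.sum_congr rfl fun j _ => by ring
    · exact Finset.sum_congr rfl fun i _ => by ring
  · ring

theorem sesqForm_smul_right (ho : IsOpen Ω) (hb : Bornology.IsBounded Ω) {v w : L2C Ω}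
    (hv : MemH1 Ω v) (c : ℂ) :
    sesqForm Ω Cm a r w (c • v) = star c * sesqForm Ω Cm a r w v := by
  rw [sesqForm, sesqForm, ← integral_const_mul]
  refine integral_congr_ae ?_
  filter_upwards [ae_weakGrad_smul ho hb hv c] with x hx
  simp only [formIntegrand, hx.1, hx.2, mul_add, Finset.mul_sum, Finset.sum_mul, star_mul']
  congr 1
  · congr 1
    · exact Finset.sum_congr rfl fun i _ => Finset.sum_congr rfl fun j _ => by ring
    · exact Finset.sum_congr rfl fun i _ => by ring
  · ring

theorem norm_le_normH1 (v : L2C Ω) : ‖v‖ ≤ normH1 Ω v := by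
  rw [normH1]
  refine Real.le_sqrt_of_sq_le ?_
  have : 0 ≤ ∑ i, ‖weakGrad Ω v i‖ ^ 2 := Finset.sum_nonneg fun i _ => by positivity
  linarith

end WeakGradient

/-! ### The discrete operator and the index of the form. -/

theorem exists_isDiscreteOp {X : Type*} [NormedAddCommGroup X] [InnerProductSpace ℂ X]
    {A : X → X → ℂ} {Vh : Submodule ℂ X} [FiniteDimensional ℂ Vh]
    (hal : ∀ u ∈ Vh, ∀ v ∈ Vh, ∀ w ∈ Vh, A (u + v) w = A u w + A v w)
    (har : ∀ u ∈ Vh, ∀ v ∈ Vh, ∀ w ∈ Vh, A w (u + v) = A w u + A w v)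
    (hsl : ∀ (c : ℂ), ∀ v ∈ Vh, ∀ w ∈ Vh, A (c • v) w = c * A v w)
    (hsr : ∀ (c : ℂ), ∀ v ∈ Vh, ∀ w ∈ Vh, A w (c • v) = star c * A w v) :
    ∃ B, IsDiscreteOp A Vh B := by
  let e := stdOrthonormalBasis ℂ Vh
  -- Riesz representation in coordinates of an orthonormal basis. The form is known to be
  -- sesquilinear only on `Vh`, hence the membership arguments throughout.
  let L : Vh →ₗ[ℂ] Vh :=
    { toFun := fun w => ∑ i, A w (e i) • e i
      map_add' := fun u v => by
        rw [← Finset.sum_add_distrib]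
        refine Finset.sum_congr rfl fun i _ => ?_
        rw [← add_smul]
        congr 1
        exact hal _ u.2 _ v.2 _ (e i).2
      map_smul' := fun c v => by
        rw [RingHom.id_apply, Finset.smul_sum]
        refine Finset.sum_congr rfl fun i _ => ?_
        rw [smul_smul]
        congr 1
        exact hsl c _ v.2 _ (e i).2 }
  refine ⟨LinearMap.toContinuousLinearMap L, fun w v => ?_⟩
  have hsum : ∀ s : Finset (Fin (Module.finrank ℂ Vh)), ∀ f : Fin (Module.finrank ℂ Vh) → ℂ,
      A w (∑ i ∈ s, f i • e i : Vh) = ∑ i ∈ s, star (f i) * A w (e i) := by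
    classical
    intro s f
    induction s using Finset.induction_on with
    | empty =>
      have h0 := hsr 0 _ (0 : Vh).2 _ w.2
      simpa using h0
    | insert i s hi ih =>
      rw [Finset.sum_insert hi, Finset.sum_insert hi, Submodule.coe_add,
        har _ (f i • e i : Vh).2 _ (∑ j ∈ s, f j • e j : Vh).2 _ w.2, ih, Submodule.coe_smul,
        hsr _ _ (e i).2 _ w.2]
  change inner ℂ v (∑ i, A w (e i) • e i) = A w v
  rw [inner_sum]
  conv_rhs => rw [← e.sum_repr' v]
  rw [hsum]
  refine Finset.sum_congr rfl fun i _ => ?_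
  rw [inner_smul_right, mul_comm]
  congr 1
  exact (inner_conj_symm v (e i)).symm

theorem isDiscreteOp_discreteOp {X : Type*} [NormedAddCommGroup X] [InnerProductSpace ℂ X]
    {A : X → X → ℂ} {Vh : Submodule ℂ X} (h : ∃ B, IsDiscreteOp A Vh B) :
    IsDiscreteOp A Vh (discreteOp A Vh) := by
  rw [discreteOp, dif_pos h]
  exact h.choose_spec

theorem formIndex_nonneg {X : Type*} (D : X → Prop) (A : X → X → ℂ) : 0 ≤ formIndex D A :=
  Real.sInf_nonneg fun _ h => h.1

/-- The infimum is attained, since each condition on `β` is closed. The admissible `M` is needed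
because the infimum of an empty set of reals is 0 by convention. -/
theorem abs_im_le_formIndex_mul_re {X : Type*} {D : X → Prop} {A : X → X → ℂ} {M : ℝ}
    (hM0 : 0 ≤ M) (hM : ∀ v, D v → |(A v v).im| ≤ M * (A v v).re)
    (hre : ∀ v, D v → 0 ≤ (A v v).re) {v : X} (hv : D v) :
    |(A v v).im| ≤ formIndex D A * (A v v).re := by
  rcases (hre v hv).eq_or_lt with h0 | h0
  · have := hM v hv
    rwa [← h0, mul_zero] at this ⊢
  · rw [← div_le_iff₀ h0]
    refine le_csInf ⟨M, hM0, hM⟩ ?_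
    rintro β ⟨-, hβ⟩
    rw [div_le_iff₀ h0]
    exact hβ v hv

theorem mainTheorem2 (α : ℝ) (hα0 : 0 < α) (hα1 : α < 1) :
    ∃ C : ℝ, 0 < C ∧
      ∀ (d : ℕ), 1 ≤ d →
      ∀ (Ω ΓD : Set (Eucl d)), IsOpen Ω → Bornology.IsBounded Ω → ΓD ⊆ frontier Ω →
      ∀ (Cm : Eucl d → Matrix (Fin d) (Fin d) ℂ) (a : Eucl d → Fin d → ℂ) (r : Eucl d → ℂ),
        -- the integral that defines the form exists on `V`
        (∀ w v : L2C Ω, MemV Ω ΓD w → MemV Ω ΓD v →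
          IntegrableOn (formIntegrand Ω Cm a r w v) Ω) →
      ∀ (c₀ c₁ : ℝ), 0 < c₀ → 0 < c₁ →
        -- strong ellipticity and continuity
        (∀ v : L2C Ω, MemV Ω ΓD v → c₀ * normH1 Ω v ^ 2 ≤ (sesqForm Ω Cm a r v v).re) →
        (∀ w v : L2C Ω, MemV Ω ΓD w → MemV Ω ΓD v →
          ‖sesqForm Ω Cm a r w v‖ ≤ c₁ * normH1 Ω w * normH1 Ω v) →
      ∀ (Vh : Submodule ℂ (L2C Ω)) [FiniteDimensional ℂ Vh], (∀ v ∈ Vh, MemV Ω ΓD v) →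
      ∀ (b : ℝ), 0 < b →
      ∀ (f : L2C Ω) (τ : ℝ), 0 < τ →
        let β : ℝ := formIndex (MemV Ω ΓD) (sesqForm Ω Cm a r)
        let Ah : Vh →L[ℂ] Vh := discreteOp (sesqForm Ω Cm a r) Vh
        let fh : Vh := Vh.orthogonalProjectionOnto f
        τ < Real.pi - Real.arctan β →
          -- the objects in the estimate are well defined
          IsDiscreteOp (sesqForm Ω Cm a r) Vh Ah ∧
          (∃ p : ℂ × ℝ, IsDunfordContour Ah p) ∧
          IsUnit (shiftedPower α b Ah) ∧
          (∀ s : ℝ, IsUnit (resolventFactor α s Ah)) ∧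
          Summable (fun n : ℤ => quadIntegrand α b Ah fh (n * τ)) ∧
          -- the error estimate
          ‖semidiscreteSol α b Ah fh - quadSol α b τ Ah fh‖ ≤
            C / b * quadFactor α β τ
              * Real.exp (-2 * Real.pi * min (kappa1 α β) (kappa2 α) / τ) * ‖fh‖ := by
  obtain ⟨C, hC0, hC⟩ := IsSectorial.norm_error_le_quadFactor hα0 hα1
  refine ⟨C, hC0, ?_⟩
  intro d _ Ω ΓD ho hbd _ Cm a r hint c₀ c₁ hc₀ hc₁ hell hcont Vh _ hVh b hb f τ hτ β Ah fh hτβ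
  have hH1 : ∀ v ∈ Vh, MemH1 Ω v := fun v hv => (hVh v hv).1
  have hAh : IsDiscreteOp (sesqForm Ω Cm a r) Vh Ah := by
    refine isDiscreteOp_discreteOp (exists_isDiscreteOp ?_ ?_ ?_ ?_)
    · exact fun u hu v hv w hw => sesqForm_add_left ho hbd (hH1 u hu) (hH1 v hv)
        (hint _ _ (hVh u hu) (hVh w hw)) (hint _ _ (hVh v hv) (hVh w hw))
    · exact fun u hu v hv w hw => sesqForm_add_right ho hbd (hH1 u hu) (hH1 v hv)
        (hint _ _ (hVh w hw) (hVh u hu)) (hint _ _ (hVh w hw) (hVh v hv))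
    · exact fun c v hv w _ => sesqForm_smul_left ho hbd (hH1 v hv) c
    · exact fun c v hv w _ => sesqForm_smul_right ho hbd (hH1 v hv) c
  have hre : ∀ v, MemV Ω ΓD v → 0 ≤ (sesqForm Ω Cm a r v v).re := fun v hv =>
    le_trans (by positivity) (hell v hv)
  -- Continuity and ellipticity together make `c₁/c₀` an admissible value, so the index is a true
  -- infimum.
  have him : ∀ v, MemV Ω ΓD v →
      |(sesqForm Ω Cm a r v v).im| ≤ c₁ / c₀ * (sesqForm Ω Cm a r v v).re := by
    intro v hv
    calc _ ≤ ‖sesqForm Ω Cm a r v v‖ := Complex.abs_im_le_norm _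
      _ ≤ c₁ * normH1 Ω v * normH1 Ω v := hcont v v hv hv
      _ = c₁ / c₀ * (c₀ * normH1 Ω v ^ 2) := by field_simp
      _ ≤ _ := by gcongr; exact hell v hv
  -- Coercivity in `H¹` implies coercivity in `L²` with the same `c₀`; the sector bound is inherited
  -- from `V` by its subspace `Vh`.
  have hsec : IsSectorial β c₀ Ah :=
    { nonneg := formIndex_nonneg _ _
      pos := hc₀
      coercive := fun v => by
        rw [hAh v v]
        refine le_trans ?_ (hell v (hVh v v.2))
        gcongr
        exact norm_le_normH1 (v : L2C Ω)
      sector := fun v => by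
        rw [hAh v v]
        exact abs_im_le_formIndex_mul_re (by positivity) him hre (hVh v v.2) }
  exact ⟨hAh, hsec.exists_isDunfordContour, hsec.isUnit_shiftedPower hα0 hα1 hb,
    hsec.isUnit_resolventFactor α, hsec.summable_quadIntegrand hα0 hα1 hb fh hτ,
    hC hsec hb fh hτ hτβ⟩
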